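/- A finite simple graph $G=(V,E)$ is a \emph{Laman graph} if $|E|=2|V|-3$ and every subgraph $(V',E')$ with $|V'|\ge 2$ satisfies $|E'|\le 2|V'|-3$. For a labeling $\lambda\colon E\to\mathbb{C}$, a \emph{compatible realization} is a map $\rho\colon V\to\mathbb{C}^2$ with $\langle\rho(u)-\rho(v),\rho(u)-\rho(v)\rangle=\lambda(\{u,v\})$ for all $\{u,v\}\in E$, where $\langle x,y\rangle=x_1y_1+x_2y_2$. Two realizations are \emph{equivalent} if they differ by a map $x\mapsto Ax+b$ with $A\in\mathbb{C}^{2\times 2}$, $AA^{T}=I$, $\det A=1$, $b\in\mathbb{C}^2$. The \emph{Laman number} $\operatorname{Lam}(G)$ is the number of equivalence classes of realizations compatible with $\lambda$ for a general labeling $\lambda$ (that is, for all $\lambda$ outside the zero set of some nonzero polynomial on $\mathbb{C}^E$). Let $M(n)$ be the largest Laman number among all Laman graphs with $n$ vertices. Let $G=(V,E)$ be a Laman graph. 1. If $|V|>2$, then for all $n\ge 2$ $$M(n)\;\ge\; 2^{(n-2)\bmod(|V|-2)}\cdot\operatorname{Lam}(G)^{\lfloor (n-2)/(|V|-2)\rfloor}.$$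 2. If $G$ contains a triangle and $|V|>3$, then for all $n\ge 3$ $$M(n)\;\ge\; 2^{(n-3)\bmod(|V|-3)}\cdot 2\cdot\left(\frac{\operatorname{Lam}(G)}{2}\right)^{\lfloor (n-3)/(|V|-3)\rfloor}.$$ 3. If $H=(W,F)$ is a subgraph of $G$ that is a Laman graph and $|W|<|V|$, then for all $n\ge |W|$ $$M(n)\;\ge\; 2^{(n-|W|)\bmod(|V|-|W|)}\cdot\operatorname{Lam}(H)\cdot\left(\frac{\operatorname{Lam}(G)}{\operatorname{Lam}(H)}\right)^{\lfloor (n-|W|)/(|V|-|W|)\rfloor}.$$ -/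

import Mathlib

namespace LamanCount

/-- A finite graph `G = (V, E)` is a Laman graph if `|E| = 2|V| - 3` and every subgraph
`(V', E')` with at least two vertices satisfies `|E'| ≤ 2|V'| - 3`. -/
def IsLaman {V : Type*} (G : SimpleGraph V) : Prop :=
  G.edgeSet.ncard + 3 = 2 * Nat.card V ∧
    ∀ G' : G.Subgraph, 2 ≤ G'.verts.ncard → G'.edgeSet.ncard + 3 ≤ 2 * G'.verts.ncard

/-- A realization of a graph with vertex set `V` in the complex plane. -/
abbrev Realization (V : Type*) := V → Fin 2 → ℂ

/-- `ρ` is compatible with the labeling `l` if `⟨ρ u - ρ v, ρ u - ρ v⟩ = l {u,v}` for all edges,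
where `⟨x, y⟩ = x₁y₁ + x₂y₂` is the (bilinear) standard form on `ℂ²`. -/
def Compatible {V : Type*} (G : SimpleGraph V) (l : G.edgeSet → ℂ) (ρ : Realization V) : Prop :=
  ∀ (u v : V) (h : G.Adj u v), (ρ u - ρ v) ⬝ᵥ (ρ u - ρ v) = l ⟨s(u, v), h⟩

/-- Two realizations are equivalent if they differ by a map `x ↦ A x + b` with `A` a complex
orthogonal matrix of determinant `1` (transpose, not conjugate transpose) and `b ∈ ℂ²`. -/
def Equivalent {V : Type*} (ρ τ : Realization V) : Prop :=
  ∃ (A : Matrix (Fin 2) (Fin 2) ℂ) (b : Fin 2 → ℂ),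
    A * A.transpose = 1 ∧ A.det = 1 ∧ ∀ v, τ v = A.mulVec (ρ v) + b

theorem Equivalent.equivalence (V : Type*) : Equivalence (Equivalent (V := V)) where
  refl ρ := ⟨1, 0, by simp, by simp, by simp⟩
  symm := by
    rintro ρ τ ⟨A, b, hA, hd, h⟩
    have hA' : A.transpose * A = 1 := mul_eq_one_comm.mp hA
    refine ⟨A.transpose, -(A.transpose.mulVec b), by simpa using hA', by simpa using hd, ?_⟩
    intro v
    rw [h v, Matrix.mulVec_add, Matrix.mulVec_mulVec, hA', Matrix.one_mulVec,
      add_neg_cancel_right]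
  trans := by
    rintro ρ τ κ ⟨A, b, hA, hd, h⟩ ⟨B, c, hB, he, k⟩
    refine ⟨B * A, B.mulVec b + c, ?_, by simp [hd, he], ?_⟩
    · rw [Matrix.transpose_mul, Matrix.mul_assoc, ← Matrix.mul_assoc A, hA, Matrix.one_mul, hB]
    · intro v
      rw [k v, h v, Matrix.mulVec_add, Matrix.mulVec_mulVec, add_assoc]

/-- Equivalence, restricted to the realizations compatible with a given labeling. -/
def realizationSetoid {V : Type*} (G : SimpleGraph V) (l : G.edgeSet → ℂ) :
    Setoid {ρ : Realization V // Compatible G l ρ} where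
  r ρ τ := Equivalent ρ.1 τ.1
  iseqv := ⟨fun _ => (Equivalent.equivalence V).refl _,
    fun h => (Equivalent.equivalence V).symm h,
    fun h k => (Equivalent.equivalence V).trans h k⟩

/-- The number (possibly infinite) of realizations compatible with `l`, up to equivalence. -/
noncomputable def numRealizations {V : Type*} (G : SimpleGraph V) (l : G.edgeSet → ℂ) : ℕ∞ :=
  ENat.card (Quotient (realizationSetoid G l))

/-- For a general labeling (outside the zero set of some nonzero polynomial in the labels),
`G` has exactly `N` compatible realizations up to equivalence. -/
def IsGenericCount {V : Type*} (G : SimpleGraph V) (N : ℕ) : Prop :=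
  ∃ P : MvPolynomial G.edgeSet ℂ, P ≠ 0 ∧
    ∀ l : G.edgeSet → ℂ, MvPolynomial.eval l P ≠ 0 → numRealizations G l = N

/-- The generic number of realizations is unique. -/
theorem IsGenericCount.unique {V : Type*} {G : SimpleGraph V} {N M : ℕ}
    (hN : IsGenericCount G N) (hM : IsGenericCount G M) : N = M := by
  obtain ⟨P, hP, hP'⟩ := hN
  obtain ⟨Q, hQ, hQ'⟩ := hM
  have hPQ : P * Q ≠ 0 := mul_ne_zero hP hQ
  obtain ⟨l, hl⟩ : ∃ l, MvPolynomial.eval l (P * Q) ≠ 0 := by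
    by_contra! h
    exact hPQ (MvPolynomial.funext fun l => by simpa using h l)
  rw [map_mul] at hl
  have h := (hP' l (left_ne_zero_of_mul hl)).symm.trans (hQ' l (right_ne_zero_of_mul hl))
  exact_mod_cast h

/-- The Laman number: the number of compatible realizations, up to equivalence, for a general
labeling (the infimum is over a set with at most one element). -/
noncomputable def lam {V : Type*} (G : SimpleGraph V) : ℕ :=
  sInf {N : ℕ | IsGenericCount G N}

/-- The largest Laman number among all Laman graphs with `n` vertices. -/
noncomputable def maxLam (n : ℕ) : ℕ :=
  sSup {N : ℕ | ∃ G : SimpleGraph (Fin n), IsLaman G ∧ lam G = N}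

/-- The set defining `maxLam n` is finite, so that the supremum is a maximum when some Laman graph
with `n` vertices exists. -/
theorem finite_lamanNumbers (n : ℕ) :
    {N : ℕ | ∃ G : SimpleGraph (Fin n), IsLaman G ∧ lam G = N}.Finite :=
  (Set.finite_range fun G : SimpleGraph (Fin n) => lam G).subset fun _ ⟨G, _, h⟩ => ⟨G, h⟩

end LamanCount

/-!
Rotations and translations are used up by prescribing, at one edge `uv`, the position of `u` and
one isotropic coordinate of the vector from `u` to `v`. The Laman number of `H` is then the number
of points in a general fibre of a polynomial map from the `2|W|` coordinates of a realization to
`2|W| - 3` edge lengths and `3` prescribed values. As both sides have the same dimension, a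
property that holds for general realizations holds for all realizations of a general labeling.

Let `G₁` and `G₂` contain the Laman graph `H`. By Chevalley's theorem the number of extensions of a
realization of `H` to one of `Gᵢ` has a constant value `cᵢ` on general realizations, so
`Lam(Gᵢ) = Lam(H) * cᵢ`, and gluing `G₁` and `G₂` along `H` gives a graph with Laman number
`Lam(H) * c₁ * c₂ = Lam(G₁) * Lam(G₂) / Lam(H)`. The glued graph is again Laman because a Laman
subgraph behaves like a single vertex in the edge count. The lower bounds come from gluing copies
of `G` along an edge, a triangle or `H`, and then triangles along edges, each of which doubles the
Laman number.
-/

namespace LamanCount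

section Generic

open MvPolynomial

variable {K ι κ : Type*} [CommRing K]

/-- A property of points of the affine space `K^ι` holds generically if it holds outside the zero
set of some nonzero polynomial. -/
def Generic (p : (ι → K) → Prop) : Prop :=
  ∃ P : MvPolynomial ι K, P ≠ 0 ∧ ∀ x, eval x P ≠ 0 → p x

namespace Generic

variable {p q : (ι → K) → Prop}

theorem mono (hp : Generic p) (hpq : ∀ x, p x → q x) : Generic q :=
  hp.imp fun _ hP => ⟨hP.1, fun x hx => hpq x (hP.2 x hx)⟩

theorem of_eval_ne_zero {P : MvPolynomial ι K} (hP : P ≠ 0) : Generic fun x => eval x P ≠ 0 :=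
  ⟨P, hP, fun _ hx => hx⟩

theorem of_forall [Nontrivial K] (hp : ∀ x, p x) : Generic p :=
  ⟨1, one_ne_zero, fun x _ => hp x⟩

theorem apply_ne_zero [Nontrivial K] (i : ι) : Generic fun x : ι → K => x i ≠ 0 :=
  (of_eval_ne_zero (X_ne_zero i)).mono fun x hx => by rwa [eval_X] at hx

theorem comp_injective (hp : Generic p) {f : ι → κ} (hf : Function.Injective f) :
    Generic fun y : κ → K => p (y ∘ f) := by
  obtain ⟨P, hP, hPp⟩ := hp
  refine ⟨rename f P, (map_ne_zero_iff _ (rename_injective f hf)).mpr hP, fun y hy => hPp _ ?_⟩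
  rwa [eval_rename] at hy

variable [IsDomain K]

theorem and (hp : Generic p) (hq : Generic q) : Generic fun x => p x ∧ q x := by
  obtain ⟨P, hP, hPp⟩ := hp
  obtain ⟨Q, hQ, hQq⟩ := hq
  refine ⟨P * Q, mul_ne_zero hP hQ, fun x hx => ?_⟩
  rw [map_mul] at hx
  exact ⟨hPp x (left_ne_zero_of_mul hx), hQq x (right_ne_zero_of_mul hx)⟩

variable [Infinite K]

theorem exists_point (hp : Generic p) : ∃ x, p x := by
  obtain ⟨P, hP, hPp⟩ := hp
  obtain ⟨x, hx⟩ : ∃ x, eval x P ≠ 0 := by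
    by_contra! h
    exact hP (MvPolynomial.funext fun x => by rw [h x, map_zero])
  exact ⟨x, hPp x hx⟩

theorem sumElim {p : (ι ⊕ κ → K) → Prop} (hp : Generic p) :
    Generic fun s : κ → K => Generic fun x : ι → K => p (Sum.elim x s) := by
  obtain ⟨P, hP, hPp⟩ := hp
  obtain ⟨z, hz⟩ := (of_eval_ne_zero hP).exists_point
  let fixLeft (x : ι → K) : MvPolynomial κ K := aeval (Sum.elim (fun i => C (x i)) X) P
  let fixRight (s : κ → K) : MvPolynomial ι K := aeval (Sum.elim X fun i => C (s i)) P
  have eval_fixLeft (x s) : eval s (fixLeft x) = eval (Sum.elim x s) P := by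
    rw [← coe_aeval_eq_eval, RingHom.coe_coe, comp_aeval_apply, ← coe_aeval_eq_eval,
      RingHom.coe_coe]
    congr 2
    ext (i | i) <;> simp
  have eval_fixRight (x s) : eval x (fixRight s) = eval (Sum.elim x s) P := by
    rw [← coe_aeval_eq_eval, RingHom.coe_coe, comp_aeval_apply, ← coe_aeval_eq_eval,
      RingHom.coe_coe]
    congr 2
    ext (i | i) <;> simp
  rw [← Sum.elim_comp_inl_inr z, ← eval_fixLeft] at hz
  refine ⟨fixLeft (z ∘ Sum.inl), fun h0 => hz (by rw [h0, map_zero]), fun s hs => ?_⟩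
  rw [eval_fixLeft, ← eval_fixRight] at hs
  exact ⟨fixRight s, fun h0 => hs (by rw [h0, map_zero]),
    fun x hx => hPp _ (by rwa [← eval_fixRight])⟩

end Generic

end Generic

section PolynomialFunctions

open MvPolynomial

variable {K ι κ : Type*} [CommRing K]

variable (K ι) in
/-- The algebra of polynomial functions on the affine space `K^ι`. -/
noncomputable def polyFun : Subalgebra K ((ι → K) → K) :=
  (aeval fun i x => x i : MvPolynomial ι K →ₐ[K] (ι → K) → K).range

theorem mem_polyFun {f : (ι → K) → K} :
    f ∈ polyFun K ι ↔ ∃ P : MvPolynomial ι K, ∀ x, eval x P = f x := by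
  have h (P : MvPolynomial ι K) :
      aeval (fun i (x : ι → K) => x i) P = fun x => eval x P := by
    ext x
    change Pi.evalAlgHom K (fun _ : ι → K => K) x (aeval _ P) = _
    rw [comp_aeval_apply, ← coe_aeval_eq_eval]
    rfl
  simp only [polyFun, AlgHom.mem_range, h, _root_.funext_iff]

theorem coord_mem_polyFun (i : ι) : (fun x : ι → K => x i) ∈ polyFun K ι :=
  mem_polyFun.mpr ⟨X i, fun _ => eval_X i⟩

theorem comp_mem_polyFun {f : (ι → K) → K} (hf : f ∈ polyFun K ι) (e : ι → κ) :
    (fun y : κ → K => f (y ∘ e)) ∈ polyFun K κ := by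
  obtain ⟨P, hP⟩ := mem_polyFun.mp hf
  exact mem_polyFun.mpr ⟨rename e P, fun y => by rw [eval_rename, hP]⟩

end PolynomialFunctions

section Constructible

open MvPolynomial PrimeSpectrum Topology

theorem exists_basicOpen_subset_or_subset_compl {A : Type*} [CommRing A] [IsDomain A]
    {s : Set (PrimeSpectrum A)} (hs : IsConstructible s) :
    ∃ P : A, P ≠ 0 ∧ ((basicOpen P : Set (PrimeSpectrum A)) ⊆ s ∨
      (basicOpen P : Set (PrimeSpectrum A)) ⊆ sᶜ) := by
  induction hs using IsConstructible.empty_union_induction with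
  | open_retrocompact U hU _ =>
    rcases U.eq_empty_or_nonempty with rfl | ⟨x, hx⟩
    · exact ⟨1, one_ne_zero, Or.inr (by simp)⟩
    · obtain ⟨_, ⟨P, rfl⟩, hxP, hPU⟩ :=
        isTopologicalBasis_basic_opens.exists_subset_of_mem_open hx hU
      refine ⟨P, ?_, Or.inl hPU⟩
      rintro rfl
      simp at hxP
  | union s _ t _ ihs iht =>
    obtain ⟨P, hP, hPs⟩ := ihs
    obtain ⟨Q, hQ, hQt⟩ := iht
    rcases hPs with hPs | hPs
    · exact ⟨P, hP, Or.inl (hPs.trans Set.subset_union_left)⟩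
    rcases hQt with hQt | hQt
    · exact ⟨Q, hQ, Or.inl (hQt.trans Set.subset_union_right)⟩
    refine ⟨P * Q, mul_ne_zero hP hQ, Or.inr ?_⟩
    rw [basicOpen_mul, Set.compl_union]
    exact Set.inter_subset_inter hPs hQt
  | compl s _ ih =>
    obtain ⟨P, hP, h⟩ := ih
    exact ⟨P, hP, by rw [compl_compl]; exact h.symm⟩

theorem exists_isMaximal_mem_of_isConstructible {A : Type*} [CommRing A] [IsJacobsonRing A]
    {s : Set (PrimeSpectrum A)} (hs : IsConstructible s) (hne : s.Nonempty) :
    ∃ x ∈ s, x.asIdeal.IsMaximal := by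
  obtain ⟨S, rfl⟩ := exists_constructibleSetData_iff.mpr hs
  obtain ⟨x, hx⟩ := hne
  obtain ⟨C, hC, hxC⟩ := Set.mem_iUnion₂.mp hx
  have hlc : IsLocallyClosed C.toSet :=
    (isClosed_zeroLocus _).isLocallyClosed.inter
      (isClosed_zeroLocus _).isOpen_compl.isLocallyClosed
  obtain ⟨y, hyC, hy⟩ := nonempty_inter_closedPoints ⟨x, hxC⟩ hlc
  exact ⟨y, Set.mem_iUnion₂.mpr ⟨C, hC, hyC⟩, (isClosed_singleton_iff_isMaximal y).mp hy⟩

variable {K ι κ : Type*} [Field K]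

/-- A property of points of the affine space `K^ι` is constructible if the points having it are
the `K`-points of a constructible subset of the spectrum of the polynomial ring. -/
def ConstructiblePred (p : (ι → K) → Prop) : Prop :=
  ∃ s : Set (PrimeSpectrum (MvPolynomial ι K)), IsConstructible s ∧
    ∀ x, p x ↔ pointToPoint x ∈ s

theorem comap_rename_pointToPoint (e : ι → κ) (y : κ → K) :
    PrimeSpectrum.comap (rename e : MvPolynomial ι K →ₐ[K] MvPolynomial κ K).toRingHom
      (pointToPoint y) = pointToPoint (k := K) (y ∘ e) := by
  ext P
  simp [pointToPoint, aeval_rename]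

theorem pointToPoint_injective :
    Function.Injective (pointToPoint : (ι → K) → PrimeSpectrum (MvPolynomial ι K)) := by
  intro x y h
  funext i
  have hy : (X i - C (y i) : MvPolynomial ι K) ∈ (pointToPoint (k := K) y).asIdeal := by
    simp [pointToPoint]
  rw [← h] at hy
  simpa [pointToPoint, mem_vanishingIdeal_singleton_iff, sub_eq_zero] using hy

namespace ConstructiblePred

variable {p q : (ι → K) → Prop}

protected theorem eq {f g : (ι → K) → K} (hf : f ∈ polyFun K ι) (hg : g ∈ polyFun K ι) :
    ConstructiblePred fun x => f x = g x := by
  obtain ⟨P, hP⟩ := mem_polyFun.mp (sub_mem hf hg)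
  refine ⟨(basicOpen P : Set (PrimeSpectrum (MvPolynomial ι K)))ᶜ,
    isConstructible_basicOpen.compl, fun x => ?_⟩
  simp [pointToPoint, hP, sub_eq_zero]

protected theorem not (hp : ConstructiblePred p) : ConstructiblePred fun x => ¬ p x := by
  obtain ⟨s, hs, hps⟩ := hp
  exact ⟨sᶜ, hs.compl, fun x => not_congr (hps x)⟩

protected theorem and (hp : ConstructiblePred p) (hq : ConstructiblePred q) :
    ConstructiblePred fun x => p x ∧ q x := by
  obtain ⟨s, hs, hps⟩ := hp
  obtain ⟨t, ht, hqt⟩ := hq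
  exact ⟨s ∩ t, hs.inter ht, fun x => and_congr (hps x) (hqt x)⟩

theorem forall_finite {α : Type*} [Finite α] {p : α → (ι → K) → Prop}
    (hp : ∀ a, ConstructiblePred (p a)) : ConstructiblePred fun x => ∀ a, p a x := by
  choose s hs hps using hp
  exact ⟨⋂ a, s a, .iInter hs, fun x => by simp only [hps, Set.mem_iInter]⟩

theorem comp [Finite κ] (hp : ConstructiblePred p) (e : ι → κ) :
    ConstructiblePred fun y : κ → K => p (y ∘ e) := by
  obtain ⟨s, hs, hps⟩ := hp
  refine ⟨PrimeSpectrum.comap (rename e : MvPolynomial ι K →ₐ[K] MvPolynomial κ K).toRingHom ⁻¹' s,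
    hs.preimage (continuous_comap _) fun t _ _ U _ _ =>
      TopologicalSpace.NoetherianSpace.isCompact _, fun y => ?_⟩
  rw [Set.mem_preimage, comap_rename_pointToPoint, ← hps]

theorem exists_sumElim [Finite ι] [Finite κ] [IsAlgClosed K] {p : (ι ⊕ κ → K) → Prop}
    (hp : ConstructiblePred p) : ConstructiblePred fun x : ι → K => ∃ y, p (Sum.elim x y) := by
  obtain ⟨s, hs, hps⟩ := hp
  let f : MvPolynomial ι K →ₐ[K] MvPolynomial (ι ⊕ κ) K := rename Sum.inl
  have hf : f.toRingHom.FinitePresentation := by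
    refine RingHom.FinitePresentation.of_comp_finiteType (algebraMap K (MvPolynomial ι K)) ?_ ?_
    · rw [AlgHom.toRingHom_eq_coe, AlgHom.comp_algebraMap, RingHom.finitePresentation_algebraMap]
      infer_instance
    · rw [RingHom.finiteType_algebraMap]
      infer_instance
  refine ⟨PrimeSpectrum.comap f.toRingHom '' s, isConstructible_comap_image hf hs, fun x => ?_⟩
  constructor
  · rintro ⟨y, hy⟩
    exact ⟨pointToPoint (Sum.elim x y), (hps _).mp hy,
      (comap_rename_pointToPoint _ _).trans (by rw [Sum.elim_comp_inl])⟩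
  · rintro ⟨m, hms, hmx⟩
    have hclosed : IsClosed {pointToPoint (k := K) x} :=
      (isClosed_singleton_iff_isMaximal _).mpr
        (isMaximal_iff_eq_vanishingIdeal_singleton.mpr ⟨x, rfl⟩)
    have hfibre : IsConstructible (s ∩ PrimeSpectrum.comap f.toRingHom ⁻¹' {pointToPoint x}) :=
      hs.inter <| isConstructible_compl.mp <|
        (TopologicalSpace.NoetherianSpace.isCompact _).isConstructible
          (hclosed.preimage (continuous_comap _)).isOpen_compl
    obtain ⟨m, ⟨hms, hmx⟩, hmax⟩ := exists_isMaximal_mem_of_isConstructible hfibre ⟨m, hms, hmx⟩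
    obtain ⟨z, hz⟩ := isMaximal_iff_eq_vanishingIdeal_singleton.mp hmax
    obtain rfl : m = pointToPoint z := PrimeSpectrum.ext hz
    have hzx : z ∘ Sum.inl = x :=
      pointToPoint_injective ((comap_rename_pointToPoint _ z).symm.trans hmx)
    exact ⟨z ∘ Sum.inr, by rwa [← hzx, Sum.elim_comp_inl_inr, hps]⟩

theorem generic_or_generic_not (hp : ConstructiblePred p) :
    Generic p ∨ Generic fun x => ¬ p x := by
  obtain ⟨s, hs, hps⟩ := hp
  obtain ⟨P, hP, hPs⟩ := exists_basicOpen_subset_or_subset_compl hs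
  have hmem (x) (hx : eval x P ≠ 0) :
      pointToPoint x ∈ (basicOpen P : Set (PrimeSpectrum (MvPolynomial ι K))) := by
    simpa [pointToPoint, mem_vanishingIdeal_singleton_iff, coe_aeval_eq_eval] using hx
  exact hPs.imp (fun h => ⟨P, hP, fun x hx => (hps x).mpr (h (hmem x hx))⟩)
    (fun h => ⟨P, hP, fun x hx => mt (hps x).mp (h (hmem x hx))⟩)

end ConstructiblePred

end Constructible

section FibreCounts

theorem natCast_le_enatCard_iff {α : Type*} {m : ℕ} :
    (m : ℕ∞) ≤ ENat.card α ↔ ∃ y : Fin m → α, Function.Injective y := by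
  have h := Cardinal.lift_mk_le' (α := Fin m) (β := α)
  rw [Cardinal.mk_fin, Cardinal.lift_natCast, Cardinal.lift_uzero] at h
  rw [ENat.card, Cardinal.natCast_le_toENat, h]
  exact ⟨fun ⟨f⟩ => ⟨f, f.injective⟩, fun ⟨y, hy⟩ => ⟨⟨y, hy⟩⟩⟩

theorem enatCard_sigma_of_forall_eq {α : Type*} {β : α → Type*} {c : ℕ}
    (h : ∀ a, ENat.card (β a) = c) : ENat.card (Σ a, β a) = ENat.card α * c := by
  have e (a) : Nonempty (β a ≃ Fin c) := by
    have : Finite (β a) := by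
      rw [← ENat.card_lt_top, h]
      exact ENat.natCast_lt_top c
    have := Fintype.ofFinite (β a)
    have hcard := h a
    rw [ENat.card_eq_coe_fintype_card, Nat.cast_inj] at hcard
    exact ⟨Fintype.equivFinOfCardEq hcard⟩
  rw [ENat.card_congr (Equiv.sigmaCongrRight fun a => (e a).some),
    ENat.card_congr (Equiv.sigmaEquivProd _ _), ENat.card_prod]
  simp

theorem enatCard_subtype_prod_of_forall_eq {α β : Type*} {p : α → Prop} {q : α → β → Prop} {c : ℕ}
    (h : ∀ x, p x → ENat.card {y // q x y} = c) :
    ENat.card {z : α × β // p z.1 ∧ q z.1 z.2} = ENat.card {x // p x} * c := by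
  let e : {z : α × β // p z.1 ∧ q z.1 z.2} ≃ Σ x : {x // p x}, {y // q x.1 y} :=
    { toFun z := ⟨⟨z.1.1, z.2.1⟩, ⟨z.1.2, z.2.2⟩⟩
      invFun z := ⟨(z.1.1, z.2.1), z.1.2, z.2.2⟩ }
  rw [ENat.card_congr e]
  exact enatCard_sigma_of_forall_eq fun x => h x.1 x.2

open MvPolynomial

theorem Generic.exists_of_enatCard_fibre_eq {K α τ : Type*} [CommRing K] {Φ : α → τ → K} {h : ℕ}
    (h0 : h ≠ 0) (hh : Generic fun t => ENat.card {x // Φ x = t} = h) :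
    Generic fun t => ∃ x, Φ x = t :=
  hh.mono fun t ht => by
    have hne : ENat.card {x // Φ x = t} ≠ 0 := by rwa [ht, Nat.cast_ne_zero]
    rwa [Ne, ENat.card_eq_zero_iff_empty, not_isEmpty_iff, nonempty_subtype] at hne

/-- Since `Φ` is dominant between spaces of equal dimension, all polynomials in the coordinates are
algebraic over those in `Φ`; hence a nonzero polynomial divides one pulled back along `Φ`. -/
theorem Generic.forall_fibre {K σ τ : Type*} [CommRing K] [IsDomain K] [Infinite K]
    [Finite σ] [Finite τ] (hcard : Nat.card τ = Nat.card σ) {Φ : (σ → K) → τ → K}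
    (hΦ : ∀ j, (fun x => Φ x j) ∈ polyFun K σ) (hdom : Generic fun t => ∃ x, Φ x = t)
    {p : (σ → K) → Prop} (hp : Generic p) : Generic fun t => ∀ x, Φ x = t → p x := by
  choose Ψ hΨ using fun j => mem_polyFun.mp (hΦ j)
  have eval_aeval (x) (Q : MvPolynomial τ K) : eval x (aeval Ψ Q) = eval (Φ x) Q := by
    rw [← coe_aeval_eq_eval, RingHom.coe_coe, comp_aeval_apply, ← coe_aeval_eq_eval,
      RingHom.coe_coe]
    congr 2
    exact _root_.funext fun j => hΨ j x
  have hind : AlgebraicIndependent K Ψ := by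
    rw [algebraicIndependent_iff]
    intro Q hQ
    by_contra hQ0
    obtain ⟨t, ⟨x, rfl⟩, ht⟩ := (hdom.and (Generic.of_eval_ne_zero hQ0)).exists_point
    exact ht (by rw [← eval_aeval, hQ, map_zero])
  have hbasis : IsTranscendenceBasis K Ψ := by
    have := Fintype.ofFinite σ
    have := Fintype.ofFinite τ
    rw [Nat.card_eq_fintype_card, Nat.card_eq_fintype_card] at hcard
    refine hind.isTranscendenceBasis_of_lift_trdeg_le_of_finite ?_
    simp [MvPolynomial.trdeg_of_isDomain, hcard]
  have halg := hbasis.isAlgebraic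
  obtain ⟨P, hP, hPp⟩ := hp
  obtain ⟨r, hr, S, hS⟩ := (halg.1 P).exists_nonzero_dvd (mem_nonZeroDivisors_of_ne_zero hP)
  obtain ⟨Q, hQ⟩ : ∃ Q, aeval Ψ Q = (r : MvPolynomial σ K) :=
    (Algebra.adjoin_range_eq_range_aeval K Ψ).le r.2
  refine ⟨Q, ?_, ?_⟩
  · rintro rfl
    exact hr (Subtype.ext (by simpa using hQ.symm))
  · rintro _ ht x rfl
    refine hPp x fun h0 => ht ?_
    change (r : MvPolynomial σ K) = _ at hS
    rw [← eval_aeval, hQ, hS, map_mul, h0, zero_mul]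

variable {K ι κ σ τ : Type*} [Field K] [IsAlgClosed K]

theorem ConstructiblePred.natCast_le_enatCard [Finite ι] [Finite κ] {p : (ι ⊕ κ → K) → Prop}
    (hp : ConstructiblePred p) (m : ℕ) :
    ConstructiblePred fun x : ι → K => (m : ℕ∞) ≤ ENat.card {y // p (Sum.elim x y)} := by
  let distinct (z : ι ⊕ (Fin m × κ) → K) : Prop :=
    ∀ a : {a : Fin m × Fin m // a.1 ≠ a.2},
      ¬ ∀ c, z (Sum.inr (a.1.1, c)) = z (Sum.inr (a.1.2, c))
  have constructible_distinct : ConstructiblePred distinct :=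
    .forall_finite fun _ => .not <| .forall_finite fun _ =>
      .eq (coord_mem_polyFun _) (coord_mem_polyFun _)
  have distinct_iff (z) :
      distinct z ↔ Function.Injective fun i c => z (Sum.inr (i, c)) := by
    simp only [distinct, Subtype.forall, Prod.forall, ← funext_iff]
    exact ⟨fun h i j hij => not_not.mp fun hne => h i j hne hij, fun h i j hne hij => hne (h hij)⟩
  have constructible_solutions : ConstructiblePred fun z : ι ⊕ (Fin m × κ) → K =>
      ∀ i : Fin m, p (z ∘ Sum.map id (i, ·)) :=
    .forall_finite fun _ => hp.comp _
  convert (constructible_solutions.and constructible_distinct).exists_sumElim with x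
  simp only [natCast_le_enatCard_iff, distinct_iff, Sum.elim_inr, Sum.elim_comp_map,
    Function.comp_id]
  constructor
  · rintro ⟨y, hy⟩
    exact ⟨fun a => (y a.1).1 a.2, fun i => (y i).2, Subtype.val_injective.comp hy⟩
  · rintro ⟨y, hy, hinj⟩
    exact ⟨fun i => ⟨fun c => y (i, c), hy i⟩, fun i j hij => hinj (congrArg Subtype.val hij)⟩

theorem ConstructiblePred.generic_enatCard_eq_or_le [Finite ι] [Finite κ] {p : (ι ⊕ κ → K) → Prop}
    (hp : ConstructiblePred p) :
    (∃ c : ℕ, Generic fun x : ι → K => ENat.card {y // p (Sum.elim x y)} = c) ∨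
      ∀ m : ℕ, Generic fun x : ι → K => (m : ℕ∞) ≤ ENat.card {y // p (Sum.elim x y)} := by
  refine or_iff_not_imp_left.mpr fun hne m => ?_
  induction m with
  | zero => exact .of_forall fun x => by simp
  | succ m ih =>
    refine (hp.natCast_le_enatCard (m + 1)).generic_or_generic_not.resolve_right fun h => ?_
    refine hne ⟨m, (ih.and h).mono fun x hx => le_antisymm ?_ hx.1⟩
    exact ENat.lt_natCast_add_one_iff.mp (not_le.mp (by exact_mod_cast hx.2))

theorem Generic.forall_fibre_sumElim {K ι σ τ : Type*} [CommRing K] [IsDomain K] [Infinite K]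
    [Finite ι] [Finite σ] [Finite τ] (hcard : Nat.card τ = Nat.card σ) {Φ : (σ → K) → τ → K}
    (hΦ : ∀ j, (fun x => Φ x j) ∈ polyFun K σ) (hdom : Generic fun t => ∃ x, Φ x = t)
    {p : (σ ⊕ ι → K) → Prop} (hp : Generic p) :
    Generic fun t : τ ⊕ ι → K => ∀ x, Φ x = t ∘ Sum.inl → p (Sum.elim x (t ∘ Sum.inr)) := by
  let Φ' (s : σ ⊕ ι → K) : τ ⊕ ι → K := Sum.elim (Φ (s ∘ Sum.inl)) (s ∘ Sum.inr)
  have hΦ' : ∀ j, (fun s => Φ' s j) ∈ polyFun K (σ ⊕ ι) := by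
    rintro (j | j)
    exacts [comp_mem_polyFun (hΦ j) Sum.inl, coord_mem_polyFun (Sum.inr j)]
  have hdom' : Generic fun t => ∃ s, Φ' s = t := by
    refine (hdom.comp_injective Sum.inl_injective).mono ?_
    rintro t ⟨x, hx⟩
    exact ⟨Sum.elim x (t ∘ Sum.inr), by simp [Φ', hx]⟩
  refine (Generic.forall_fibre (by simp [Nat.card_sum, hcard]) hΦ' hdom' hp).mono ?_
  intro t ht x hx
  exact ht _ (by simp [Φ', hx])

variable [Finite ι] [Finite κ] [Finite σ] [Finite τ] {Φ : (σ → K) → τ → K}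

/-- `q x s y` is to be read as a system of conditions, with parameters `s`, that extends a solution
`x` of the system `Φ x = t` by further coordinates `y`. -/
theorem exists_generic_extension_count (hcard : Nat.card τ = Nat.card σ)
    (hΦ : ∀ j, (fun x => Φ x j) ∈ polyFun K σ)
    {q : (σ → K) → (ι → K) → (κ → K) → Prop}
    (hq : ConstructiblePred fun z : (σ ⊕ ι) ⊕ κ → K =>
      q (z ∘ Sum.inl ∘ Sum.inl) (z ∘ Sum.inl ∘ Sum.inr) (z ∘ Sum.inr))
    {h g : ℕ} (h0 : h ≠ 0) (hh : Generic fun t => ENat.card {x // Φ x = t} = h)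
    (hg : Generic fun t : τ ⊕ ι → K => ENat.card {z : (σ → K) × (κ → K) //
      Φ z.1 = t ∘ Sum.inl ∧ q z.1 (t ∘ Sum.inr) z.2} = g) :
    ∃ c : ℕ, g = h * c ∧ Generic fun t : τ ⊕ ι → K =>
      ∀ x, Φ x = t ∘ Sum.inl → ENat.card {y // q x (t ∘ Sum.inr) y} = c := by
  have hdom := Generic.exists_of_enatCard_fibre_eq h0 hh
  rcases hq.generic_enatCard_eq_or_le with ⟨c, hc⟩ | hunbounded
  · have hcount := Generic.forall_fibre_sumElim hcard hΦ hdom hc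
    refine ⟨c, ?_, hcount⟩
    obtain ⟨t, ⟨htc, htg⟩, hth⟩ :=
      ((hcount.and hg).and (hh.comp_injective Sum.inl_injective)).exists_point
    have := enatCard_subtype_prod_of_forall_eq htc
    rw [hth] at this
    exact_mod_cast htg.symm.trans this
  · obtain ⟨t, ⟨hlarge, x, hx⟩, htg⟩ :=
      (((Generic.forall_fibre_sumElim hcard hΦ hdom (hunbounded (g + 1))).and
        (hdom.comp_injective Sum.inl_injective)).and hg).exists_point
    have hle := ENat.card_le_card_of_injective (f := fun y : {y // q x (t ∘ Sum.inr) y} =>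
      (⟨(x, y.1), hx, y.2⟩ : {z : (σ → K) × (κ → K) //
        Φ z.1 = t ∘ Sum.inl ∧ q z.1 (t ∘ Sum.inr) z.2})) fun y y' hy => by
          simpa [Subtype.ext_iff] using hy
    have : g + 1 ≤ g := by exact_mod_cast (hlarge x hx).trans (hle.trans_eq htg)
    omega

theorem exists_generic_glued_count {ι' κ' : Type*} [Finite ι'] [Finite κ']
    (hcard : Nat.card τ = Nat.card σ) (hΦ : ∀ j, (fun x => Φ x j) ∈ polyFun K σ)
    {q : (σ → K) → (ι → K) → (κ → K) → Prop} {q' : (σ → K) → (ι' → K) → (κ' → K) → Prop}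
    (hq : ConstructiblePred fun z : (σ ⊕ ι) ⊕ κ → K =>
      q (z ∘ Sum.inl ∘ Sum.inl) (z ∘ Sum.inl ∘ Sum.inr) (z ∘ Sum.inr))
    (hq' : ConstructiblePred fun z : (σ ⊕ ι') ⊕ κ' → K =>
      q' (z ∘ Sum.inl ∘ Sum.inl) (z ∘ Sum.inl ∘ Sum.inr) (z ∘ Sum.inr))
    {h g g' : ℕ} (h0 : h ≠ 0) (hh : Generic fun t => ENat.card {x // Φ x = t} = h)
    (hg : Generic fun t : τ ⊕ ι → K => ENat.card {z : (σ → K) × (κ → K) //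
      Φ z.1 = t ∘ Sum.inl ∧ q z.1 (t ∘ Sum.inr) z.2} = g)
    (hg' : Generic fun t : τ ⊕ ι' → K => ENat.card {z : (σ → K) × (κ' → K) //
      Φ z.1 = t ∘ Sum.inl ∧ q' z.1 (t ∘ Sum.inr) z.2} = g') :
    ∃ N : ℕ, h * N = g * g' ∧ Generic fun t : τ ⊕ (ι ⊕ ι') → K =>
      ENat.card {z : (σ → K) × ((κ → K) × (κ' → K)) // Φ z.1 = t ∘ Sum.inl ∧
        (q z.1 (t ∘ Sum.inr ∘ Sum.inl) z.2.1 ∧ q' z.1 (t ∘ Sum.inr ∘ Sum.inr) z.2.2)} = N := by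
  obtain ⟨c, rfl, hc⟩ := exists_generic_extension_count hcard hΦ hq h0 hh hg
  obtain ⟨c', rfl, hc'⟩ := exists_generic_extension_count hcard hΦ hq' h0 hh hg'
  refine ⟨h * (c * c'), by ring, ?_⟩
  have left_injective : Function.Injective (Sum.map id Sum.inl : τ ⊕ ι → τ ⊕ (ι ⊕ ι')) :=
    Function.injective_id.sumMap Sum.inl_injective
  have right_injective : Function.Injective (Sum.map id Sum.inr : τ ⊕ ι' → τ ⊕ (ι ⊕ ι')) :=
    Function.injective_id.sumMap Sum.inr_injective
  refine (((hc.comp_injective left_injective).and (hc'.comp_injective right_injective)).and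
    (hh.comp_injective Sum.inl_injective)).mono ?_
  rintro t ⟨⟨htc, htc'⟩, hth⟩
  have htcc' (x) (hx : Φ x = t ∘ Sum.inl) : ENat.card {y : (κ → K) × (κ' → K) //
      q x (t ∘ Sum.inr ∘ Sum.inl) y.1 ∧ q' x (t ∘ Sum.inr ∘ Sum.inr) y.2} = (c * c' : ℕ) := by
    rw [ENat.card_congr Equiv.subtypeProdEquivProd, ENat.card_prod, Nat.cast_mul]
    exact congrArg₂ _ (htc x hx) (htc' x hx)
  rw [enatCard_subtype_prod_of_forall_eq htcc', hth]
  simp only [Nat.cast_mul]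

end FibreCounts

section Isotropic

open Matrix

/-- The coordinates of `ℂ²` with respect to the two isotropic lines of the standard form, which is
the product of these coordinates. Rotations act on them by mutually inverse scalars. -/
noncomputable def isotropic : (Fin 2 → ℂ) ≃ₗ[ℂ] ℂ × ℂ where
  toFun p := (p 0 + Complex.I * p 1, p 0 - Complex.I * p 1)
  map_add' p q := by ext <;> simp only [Pi.add_apply, Prod.mk_add_mk] <;> ring
  map_smul' c p := by
    ext <;> simp only [Pi.smul_apply, smul_eq_mul, RingHom.id_apply, Prod.smul_mk] <;> ring
  invFun z := ![(z.1 + z.2) / 2, -Complex.I * (z.1 - z.2) / 2]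
  left_inv p := by
    ext i
    fin_cases i
    · simp only [Fin.zero_eta, cons_val_zero]
      ring
    · simp only [Fin.mk_one, cons_val_one, cons_val_fin_one]
      linear_combination -(p 1) * Complex.I_sq
  right_inv z := by
    ext <;> simp only [cons_val_zero, cons_val_one, cons_val_fin_one]
    · linear_combination -(z.1 - z.2) / 2 * Complex.I_sq
    · linear_combination (z.1 - z.2) / 2 * Complex.I_sq

theorem isotropic_apply (p : Fin 2 → ℂ) :
    isotropic p = (p 0 + Complex.I * p 1, p 0 - Complex.I * p 1) := rfl

theorem dotProduct_self_eq_isotropic (p : Fin 2 → ℂ) :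
    p ⬝ᵥ p = (isotropic p).1 * (isotropic p).2 := by
  simp only [dotProduct, Fin.sum_univ_two, isotropic_apply]
  linear_combination (p 1) ^ 2 * Complex.I_sq

theorem isotropic_mulVec (a b : ℂ) (p : Fin 2 → ℂ) :
    isotropic (!![a, b; -b, a] *ᵥ p) =
      ((a - Complex.I * b) * (isotropic p).1, (a + Complex.I * b) * (isotropic p).2) := by
  simp only [isotropic_apply, mulVec, dotProduct, Fin.sum_univ_two, of_apply, cons_val_zero,
    cons_val_one, cons_val_fin_one, Prod.mk.injEq]
  constructor
  · linear_combination b * p 1 * Complex.I_sq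
  · linear_combination b * p 1 * Complex.I_sq

theorem exists_isotropic_mulVec_eq {A : Matrix (Fin 2) (Fin 2) ℂ} (hA : A * Aᵀ = 1)
    (hdet : A.det = 1) :
    ∃ c : ℂ, c ≠ 0 ∧
      ∀ p, isotropic (A *ᵥ p) = (c * (isotropic p).1, c⁻¹ * (isotropic p).2) := by
  have hadj : Aᵀ = A.adjugate := by
    rw [← inv_eq_right_inv hA, inv_def, hdet, Ring.inverse_one, one_smul]
  have h11 : A 0 0 = A 1 1 := by simpa [adjugate_fin_two] using congrFun₂ hadj 0 0
  have h10 : A 1 0 = -A 0 1 := by simpa [adjugate_fin_two] using congrFun₂ hadj 0 1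
  have hform : A = !![A 0 0, A 0 1; -A 0 1, A 0 0] := by
    conv_lhs => rw [eta_fin_two A, h10, ← h11]
  have hprod : (A 0 0 - Complex.I * A 0 1) * (A 0 0 + Complex.I * A 0 1) = 1 := by
    rw [det_fin_two, ← h11, h10] at hdet
    linear_combination hdet - A 0 1 ^ 2 * Complex.I_sq
  refine ⟨A 0 0 - Complex.I * A 0 1, left_ne_zero_of_mul_eq_one hprod, fun p => ?_⟩
  rw [hform, isotropic_mulVec, inv_eq_of_mul_eq_one_right]
  · rfl
  · exact hprod

theorem exists_mulVec_isotropic_eq {c : ℂ} (hc : c ≠ 0) :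
    ∃ A : Matrix (Fin 2) (Fin 2) ℂ, A * Aᵀ = 1 ∧ A.det = 1 ∧
      ∀ p, isotropic (A *ᵥ p) = (c * (isotropic p).1, c⁻¹ * (isotropic p).2) := by
  obtain ⟨a, ha⟩ : ∃ a, a = (c + c⁻¹) / 2 := ⟨_, rfl⟩
  obtain ⟨b, hb⟩ : ∃ b, b = Complex.I * (c - c⁻¹) / 2 := ⟨_, rfl⟩
  have hsub : a - Complex.I * b = c := by
    rw [ha, hb]
    linear_combination -(c - c⁻¹) / 2 * Complex.I_sq
  have hadd : a + Complex.I * b = c⁻¹ := by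
    rw [ha, hb]
    linear_combination (c - c⁻¹) / 2 * Complex.I_sq
  have hab : a * a + b * b = 1 := by
    have hprod : (a - Complex.I * b) * (a + Complex.I * b) = 1 := by
      rw [hsub, hadd, mul_inv_cancel₀ hc]
    linear_combination hprod + b ^ 2 * Complex.I_sq
  refine ⟨!![a, b; -b, a], ?_, ?_, fun p => by rw [isotropic_mulVec, hsub, hadd]⟩
  · have htranspose : !![a, b; -b, a]ᵀ = !![a, -b; b, a] := by
      ext i j
      fin_cases i <;> fin_cases j <;> rfl
    rw [htranspose, mul_fin_two, one_fin_two, neg_mul_neg, add_comm (b * b), hab]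
    simp only [mul_neg, neg_mul, mul_comm b a, neg_add_cancel]
  · rw [det_fin_two_of]
    linear_combination hab

theorem equivalent_iff_isotropic {V : Type*} {ρ τ : Realization V} (u : V) :
    Equivalent ρ τ ↔ ∃ c : ℂ, c ≠ 0 ∧ ∀ w, isotropic (τ w - τ u) =
      (c * (isotropic (ρ w - ρ u)).1, c⁻¹ * (isotropic (ρ w - ρ u)).2) := by
  constructor
  · rintro ⟨A, b, hA, hdet, h⟩
    obtain ⟨c, hc, hAc⟩ := exists_isotropic_mulVec_eq hA hdet
    exact ⟨c, hc, fun w => by rw [h, h, add_sub_add_right_eq_sub, ← mulVec_sub, hAc]⟩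
  · rintro ⟨c, hc, h⟩
    obtain ⟨A, hA, hdet, hAc⟩ := exists_mulVec_isotropic_eq hc
    refine ⟨A, τ u - A *ᵥ ρ u, hA, hdet, fun w => ?_⟩
    have hw : τ w - τ u = A *ᵥ (ρ w - ρ u) := isotropic.injective (by rw [h, hAc])
    rw [← sub_add_cancel (τ w) (τ u), hw, mulVec_sub]
    abel

end Isotropic

section Anchored

variable {V W : Type*}

/-- The squared lengths of the vectors between the vertices of a realization, as a function on
unordered pairs. -/
def sqLen (ρ : Realization V) : Sym2 V → ℂ :=
  Sym2.lift ⟨fun u v => (ρ u - ρ v) ⬝ᵥ (ρ u - ρ v), fun u v => by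
    simp only [← neg_sub (ρ v) (ρ u), neg_dotProduct_neg]⟩

theorem sqLen_mk (ρ : Realization V) (u v : V) :
    sqLen ρ s(u, v) = (ρ u - ρ v) ⬝ᵥ (ρ u - ρ v) := rfl

theorem sqLen_eq_isotropic (ρ : Realization V) (u v : V) :
    sqLen ρ s(u, v) = (isotropic (ρ v - ρ u)).1 * (isotropic (ρ v - ρ u)).2 := by
  rw [Sym2.eq_swap, sqLen_mk, dotProduct_self_eq_isotropic]

theorem sqLen_comp (ρ : Realization V) (f : W → V) (e : Sym2 W) :
    sqLen (ρ ∘ f) e = sqLen ρ (e.map f) := by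
  induction e with | _ a b => rfl

theorem compatible_iff_sqLen {G : SimpleGraph V} {l : G.edgeSet → ℂ} {ρ : Realization V} :
    Compatible G l ρ ↔ ∀ e : G.edgeSet, sqLen ρ e = l e := by
  constructor
  · rintro h ⟨e, he⟩
    induction e with | _ a b => exact h a b he
  · intro h u v huv
    exact h ⟨s(u, v), huv⟩

theorem Equivalent.sqLen_eq {ρ τ : Realization V} (h : Equivalent ρ τ) : sqLen τ = sqLen ρ := by
  ext e
  induction e with | _ a b =>
  obtain ⟨c, hc, h⟩ := (equivalent_iff_isotropic a).mp h
  rw [sqLen_eq_isotropic, sqLen_eq_isotropic, h, mul_mul_mul_comm, mul_inv_cancel₀ hc, one_mul]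

/-- The position of `u` and the first isotropic coordinate of the vector from `u` to `v`.
Prescribing these three values selects one representative of each equivalence class of
realizations. -/
noncomputable def anchor (u v : V) (ρ : Realization V) : Fin 3 → ℂ :=
  ![ρ u 0, ρ u 1, (isotropic (ρ v - ρ u)).1]

theorem anchor_eq_iff {u v : V} {ρ : Realization V} {s : Fin 3 → ℂ} :
    anchor u v ρ = s ↔ ρ u = ![s 0, s 1] ∧ (isotropic (ρ v - ρ u)).1 = s 2 := by
  simp [funext_iff, Fin.forall_fin_succ, anchor, and_assoc]

theorem Equivalent.eq_of_anchor_eq {u v : V} {ρ τ : Realization V} (h : Equivalent ρ τ)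
    {s : Fin 3 → ℂ} (hs : s 2 ≠ 0) (hρ : anchor u v ρ = s) (hτ : anchor u v τ = s) : ρ = τ := by
  obtain ⟨c, -, h⟩ := (equivalent_iff_isotropic u).mp h
  obtain ⟨hρu, hρv⟩ := anchor_eq_iff.mp hρ
  obtain ⟨hτu, hτv⟩ := anchor_eq_iff.mp hτ
  have hc : c = 1 := by
    have hv := congrArg Prod.fst (h v)
    rw [hρv, hτv] at hv
    exact (right_eq_mul₀ hs).mp hv
  ext1 w
  have hw := h w
  rw [hc, inv_one, one_mul, one_mul, Prod.mk.eta, isotropic.injective.eq_iff, hρu, hτu] at hw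
  exact (sub_left_injective hw).symm

theorem exists_equivalent_anchor_eq {u v : V} {ρ : Realization V}
    (hρ : (isotropic (ρ v - ρ u)).1 ≠ 0) {s : Fin 3 → ℂ} (hs : s 2 ≠ 0) :
    ∃ τ, Equivalent ρ τ ∧ anchor u v τ = s := by
  let c := s 2 / (isotropic (ρ v - ρ u)).1
  let τ (w : V) : Fin 2 → ℂ := ![s 0, s 1] +
    isotropic.symm (c * (isotropic (ρ w - ρ u)).1, c⁻¹ * (isotropic (ρ w - ρ u)).2)
  have hτu : τ u = ![s 0, s 1] := by simp [τ, ← Prod.zero_eq_mk]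
  have hτ (w) : isotropic (τ w - τ u) =
      (c * (isotropic (ρ w - ρ u)).1, c⁻¹ * (isotropic (ρ w - ρ u)).2) := by
    rw [hτu, add_sub_cancel_left, LinearEquiv.apply_symm_apply]
  refine ⟨τ, (equivalent_iff_isotropic u).mpr ⟨c, div_ne_zero hs hρ, hτ⟩,
    anchor_eq_iff.mpr ⟨hτu, ?_⟩⟩
  rw [hτ]
  exact div_mul_cancel₀ _ hρ

theorem numRealizations_eq_enatCard_anchored {G : SimpleGraph V} {u v : V} (h : G.Adj u v)
    {l : G.edgeSet → ℂ} (hl : l ⟨s(u, v), h⟩ ≠ 0) {s : Fin 3 → ℂ} (hs : s 2 ≠ 0) :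
    numRealizations G l =
      ENat.card {ρ : Realization V // (∀ e : G.edgeSet, sqLen ρ e = l e) ∧ anchor u v ρ = s} := by
  let toClass (ρ : {ρ : Realization V // (∀ e : G.edgeSet, sqLen ρ e = l e) ∧ anchor u v ρ = s}) :
      Quotient (realizationSetoid G l) :=
    Quotient.mk _ ⟨ρ.1, compatible_iff_sqLen.mpr ρ.2.1⟩
  refine (ENat.card_congr (Equiv.ofBijective toClass ⟨?_, ?_⟩)).symm
  · rintro ⟨ρ, _, hρ⟩ ⟨τ, _, hτ⟩ hρτ
    exact Subtype.ext (Equivalent.eq_of_anchor_eq (Quotient.exact hρτ) hs hρ hτ)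
  · intro q
    induction q using Quotient.inductionOn with | _ ρ =>
    obtain ⟨ρ, hρ⟩ := ρ
    rw [compatible_iff_sqLen] at hρ
    have hne : (isotropic (ρ v - ρ u)).1 ≠ 0 := by
      rw [← hρ, sqLen_eq_isotropic] at hl
      exact left_ne_zero_of_mul hl
    obtain ⟨τ, hρτ, hτ⟩ := exists_equivalent_anchor_eq hne hs
    exact ⟨⟨τ, fun e => by rw [hρτ.sqLen_eq, hρ e], hτ⟩,
      Quotient.sound ((Equivalent.equivalence V).symm hρτ)⟩

theorem isGenericCount_iff_anchored {τ : Type*} {G : SimpleGraph V} {u v : V} (h : G.Adj u v)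
    {N : ℕ} {ε : τ → Sym2 V} (hε : Function.Injective ε) (hrange : Set.range ε = G.edgeSet) :
    IsGenericCount G N ↔ Generic fun t : τ ⊕ Fin 3 → ℂ =>
      ENat.card {ρ : Realization V //
        (∀ e, sqLen ρ (ε e) = t (Sum.inl e)) ∧ anchor u v ρ = t ∘ Sum.inr} = N := by
  let φ : τ ≃ G.edgeSet := (Equiv.ofInjective ε hε).trans (Equiv.setCongr hrange)
  have count_eq (l : G.edgeSet → ℂ) (s : Fin 3 → ℂ) (hl : l ⟨s(u, v), h⟩ ≠ 0) (hs : s 2 ≠ 0) :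
      numRealizations G l = ENat.card {ρ : Realization V //
        (∀ e, sqLen ρ (ε e) = l (φ e)) ∧ anchor u v ρ = s} := by
    rw [numRealizations_eq_enatCard_anchored h hl hs]
    simp only [← φ.forall_congr_right]
    rfl
  change (Generic fun l => numRealizations G l = N) ↔ _
  constructor
  · intro hG
    refine ((hG.comp_injective (f := fun e => (Sum.inl (φ.symm e) : τ ⊕ Fin 3))
      (Sum.inl_injective.comp φ.symm.injective)).and
      ((Generic.apply_ne_zero (Sum.inl (φ.symm ⟨s(u, v), h⟩))).and
        (Generic.apply_ne_zero (Sum.inr 2)))).mono ?_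
    rintro t ⟨ht, hl, hs⟩
    rw [← ht, count_eq _ (t ∘ Sum.inr) hl hs]
    simp
  · intro hG
    obtain ⟨s, hGs, hs⟩ := (hG.sumElim.and (Generic.apply_ne_zero 2)).exists_point
    refine ((hGs.comp_injective φ.injective).and (Generic.apply_ne_zero ⟨s(u, v), h⟩)).mono ?_
    rintro l ⟨hl, hl0⟩
    rw [count_eq l s hl0 hs, ← hl]
    rfl

theorem IsGenericCount.of_iso {G : SimpleGraph V} {G' : SimpleGraph W} (f : G ≃g G') {u v : V}
    (h : G.Adj u v) {N : ℕ} (hG : IsGenericCount G N) : IsGenericCount G' N := by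
  have hrange : Set.range (fun e : G.edgeSet => (e : Sym2 V).map f) = G'.edgeSet := by
    have hcomp : (fun e : G.edgeSet => (e : Sym2 V).map f) = Subtype.val ∘ f.mapEdgeSet := rfl
    rw [hcomp, Set.range_comp, f.mapEdgeSet.range_eq_univ, Set.image_univ, Subtype.range_val]
  rw [isGenericCount_iff_anchored h Subtype.val_injective Subtype.range_val] at hG
  rw [isGenericCount_iff_anchored (f.map_adj_iff.mpr h)
    ((Sym2.map.injective f.injective).comp Subtype.val_injective) hrange]
  refine hG.mono fun t ht => ?_
  rw [← ht]
  refine ENat.card_congr (Equiv.subtypeEquiv (f.symm.toEquiv.arrowCongr (Equiv.refl _)) fun ρ => ?_)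
  change _ ↔ (∀ e : G.edgeSet, sqLen (ρ ∘ f) e = _) ∧ anchor u v (ρ ∘ f) = _
  simp only [sqLen_comp]
  rfl

end Anchored

section Laman

variable {V W : Type*} {G : SimpleGraph V} {H : SimpleGraph W} {S T : Set V}

/-- The edges of `G` with both endpoints in `S`. -/
def edgesWithin (G : SimpleGraph V) (S : Set V) : Set (Sym2 V) :=
  G.edgeSet ∩ S.sym2

theorem edgesWithin_mono (h : S ⊆ T) : edgesWithin G S ⊆ edgesWithin G T := by
  rintro ⟨a, b⟩ ⟨hab, ha, hb⟩
  exact ⟨hab, h ha, h hb⟩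

theorem edgesWithin_inter : edgesWithin G (S ∩ T) = edgesWithin G S ∩ edgesWithin G T := by
  rw [edgesWithin, Set.sym2_inter, Set.inter_inter_distrib_left]
  rfl

theorem edgesWithin_univ : edgesWithin G Set.univ = G.edgeSet := by
  rw [edgesWithin, Set.sym2_univ, Set.inter_univ]

theorem edgesWithin_image (f : H ↪g G) (X : Set W) :
    edgesWithin G (f '' X) = Sym2.map f '' edgesWithin H X := by
  ext e
  constructor
  · induction e with | _ a b =>
    rintro ⟨hab, ⟨x, hx, rfl⟩, y, hy, rfl⟩
    exact ⟨s(x, y), ⟨f.map_adj_iff.mp hab, hx, hy⟩, rfl⟩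
  · rintro ⟨⟨x, y⟩, ⟨hxy, hx, hy⟩, rfl⟩
    exact ⟨f.map_adj_iff.mpr hxy, Set.mem_image_of_mem f hx, Set.mem_image_of_mem f hy⟩

theorem ncard_edgesWithin_image (f : H ↪g G) (X : Set W) :
    (edgesWithin G (f '' X)).ncard = (edgesWithin H X).ncard := by
  rw [edgesWithin_image, Set.ncard_image_of_injective _ (Sym2.map.injective f.injective)]

theorem finite_edgesWithin (hS : S.Finite) : (edgesWithin G S).Finite := by
  refine .inter_of_right ?_ _
  rw [Set.sym2_eq_mk_image]
  exact (hS.prod hS).image _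

theorem ncard_edgesWithin_eq_zero (hS : S.Finite) (h : S.ncard ≤ 1) :
    (edgesWithin G S).ncard = 0 := by
  rw [Set.ncard_eq_zero (finite_edgesWithin hS)]
  refine Set.eq_empty_of_forall_notMem fun e he => ?_
  induction e with | _ a b =>
  obtain ⟨hab, ha, hb⟩ := he
  exact G.ne_of_adj hab ((Set.ncard_le_one hS).mp h a ha b hb)

theorem ncard_edgesWithin_add_le (hS : S.Finite) (hT : T.Finite) :
    (edgesWithin G S).ncard + (edgesWithin G T).ncard ≤
      (edgesWithin G (S ∪ T)).ncard + (edgesWithin G (S ∩ T)).ncard := by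
  rw [← Set.ncard_union_add_ncard_inter _ _ (finite_edgesWithin hS) (finite_edgesWithin hT),
    edgesWithin_inter]
  gcongr
  · exact finite_edgesWithin (hS.union hT)
  · exact Set.union_subset (edgesWithin_mono Set.subset_union_left)
      (edgesWithin_mono Set.subset_union_right)

theorem ncard_edgesWithin_add_inter {X : Set V} (hX : X.Finite)
    (h : edgesWithin G X ⊆ S.sym2 ∪ T.sym2) :
    (edgesWithin G X).ncard + (edgesWithin G (X ∩ (S ∩ T))).ncard =
      (edgesWithin G (X ∩ S)).ncard + (edgesWithin G (X ∩ T)).ncard := by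
  rw [← Set.ncard_union_add_ncard_inter _ _ (finite_edgesWithin (hX.inter_of_left S))
    (finite_edgesWithin (hX.inter_of_left T)), ← edgesWithin_inter, ← Set.inter_inter_distrib_left]
  congr 2
  refine Set.Subset.antisymm (fun e he => ?_) (Set.union_subset
    (edgesWithin_mono Set.inter_subset_left) (edgesWithin_mono Set.inter_subset_left))
  rw [edgesWithin_inter, edgesWithin_inter]
  exact (h he).imp (⟨he, he.1, ·⟩) (⟨he, he.1, ·⟩)

/-- The vertex set `S` induces a Laman graph in `G`. -/
def IsLamanOn (G : SimpleGraph V) (S : Set V) : Prop :=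
  (edgesWithin G S).ncard + 3 = 2 * S.ncard ∧
    ∀ X ⊆ S, 2 ≤ X.ncard → (edgesWithin G X).ncard + 3 ≤ 2 * X.ncard

theorem IsLamanOn.finite (h : IsLamanOn G S) : S.Finite :=
  Set.finite_of_ncard_ne_zero (by have := h.1; omega)

/-- A vertex set that induces a Laman graph behaves like a single vertex. -/
theorem IsLamanOn.ncard_edgesWithin_add_two_mul_le (hS : IsLamanOn G S) (hT : IsLamanOn G T)
    (hTS : T ⊆ S) {X : Set V} (hX : X ⊆ S) :
    (edgesWithin G X).ncard + 2 * (X ∩ T).ncard ≤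
      (edgesWithin G (X ∩ T)).ncard + 2 * X.ncard := by
  have hXfin := hS.finite.subset hX
  have hXT : X ∪ T ⊆ S := Set.union_subset hX hTS
  have hedges := ncard_edgesWithin_add_le (G := G) hXfin hT.finite
  have hverts := Set.ncard_union_add_ncard_inter X T hXfin hT.finite
  have hle := Set.ncard_le_ncard (Set.subset_union_right (s := X) (t := T))
    (hS.finite.subset hXT)
  have hsparse := hS.2 (X ∪ T) hXT
  have := hT.1
  omega

theorem IsLamanOn.union (hS : IsLamanOn G S) (hT : IsLamanOn G T) (hST : IsLamanOn G (S ∩ T))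
    (h : edgesWithin G (S ∪ T) ⊆ S.sym2 ∪ T.sym2) : IsLamanOn G (S ∪ T) := by
  have hedges : ∀ X ⊆ S ∪ T, _ := fun X hX =>
    ncard_edgesWithin_add_inter ((hS.finite.union hT.finite).subset hX)
      ((edgesWithin_mono hX).trans h)
  have hverts : ∀ X ⊆ S ∪ T,
      X.ncard + (X ∩ (S ∩ T)).ncard = (X ∩ S).ncard + (X ∩ T).ncard := fun X hX => by
    rw [← Set.ncard_union_add_ncard_inter _ _ (hS.finite.inter_of_right X)
      (hT.finite.inter_of_right X), ← Set.inter_union_distrib_left,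
      ← Set.inter_inter_distrib_left, Set.inter_eq_left.mpr hX]
  refine ⟨?_, fun X hX hX2 => ?_⟩
  · have hedges := hedges _ subset_rfl
    have hverts := hverts _ subset_rfl
    rw [Set.union_inter_cancel_left, Set.union_inter_cancel_right, Set.inter_eq_right.mpr
      (Set.inter_subset_left.trans Set.subset_union_left)] at hedges hverts
    have := hS.1
    have := hT.1
    have := hST.1
    omega
  · have hedges := hedges X hX
    have hverts := hverts X hX
    have hleS := hS.ncard_edgesWithin_add_two_mul_le hST Set.inter_subset_left
      (Set.inter_subset_right (s := X))
    have hleT := hT.ncard_edgesWithin_add_two_mul_le hST Set.inter_subset_right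
      (Set.inter_subset_right (s := X))
    rw [Set.inter_assoc, ← Set.inter_assoc S S, Set.inter_self] at hleS
    rw [Set.inter_assoc, Set.inter_left_comm T, Set.inter_self] at hleT
    have hS2 := hS.2 (X ∩ S) Set.inter_subset_right
    have hT2 := hT.2 (X ∩ T) Set.inter_subset_right
    have hS1 := ncard_edgesWithin_eq_zero (G := G) (hS.finite.inter_of_right X)
    have hT1 := ncard_edgesWithin_eq_zero (G := G) (hT.finite.inter_of_right X)
    omega

theorem IsLaman.finite (hG : IsLaman G) : Finite V :=
  Nat.finite_of_card_ne_zero (by have := hG.1; omega)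

theorem IsLaman.exists_adj (hG : IsLaman G) : ∃ u v, G.Adj u v := by
  by_contra! h
  have hempty : G.edgeSet = ∅ := Set.eq_empty_of_forall_notMem fun e => by
    induction e with | _ a b => exact h a b
  have := hG.1
  rw [hempty, Set.ncard_empty] at this
  omega

theorem isLaman_iff_isLamanOn_univ : IsLaman G ↔ IsLamanOn G Set.univ := by
  rw [IsLaman, IsLamanOn, edgesWithin_univ, Set.ncard_univ]
  refine and_congr_right fun hcard => ⟨fun h X _ hX => ?_, fun h G' hG' => ?_⟩
  · have hedges : (((⊤ : G.Subgraph).induce X).edgeSet) = edgesWithin G X := by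
      ext e
      induction e with | _ a b =>
      simp [edgesWithin, and_comm, and_assoc]
    rw [← hedges]
    exact h ((⊤ : G.Subgraph).induce X) hX
  · have : Finite V := Nat.finite_of_card_ne_zero (by omega)
    refine le_trans ?_ (h G'.verts (Set.subset_univ _) hG')
    gcongr
    · exact finite_edgesWithin (Set.toFinite _)
    · exact fun e he => ⟨G'.edgeSet_subset he, Set.mem_sym2_iff_subset.mpr fun x hx =>
        G'.mem_verts_of_mem_edge he hx⟩

theorem isLaman_iff_isLamanOn_range (f : H ↪g G) : IsLaman H ↔ IsLamanOn G (Set.range f) := by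
  rw [isLaman_iff_isLamanOn_univ, IsLamanOn, IsLamanOn, ← Set.image_univ,
    ncard_edgesWithin_image, Set.ncard_image_of_injective _ f.injective]
  simp only [Set.forall_subset_image_iff, ncard_edgesWithin_image,
    Set.ncard_image_of_injective _ f.injective]

theorem IsLaman.of_iso (f : H ≃g G) (hH : IsLaman H) : IsLaman G := by
  rw [isLaman_iff_isLamanOn_univ, ← f.surjective.range_eq]
  exact (isLaman_iff_isLamanOn_range f.toEmbedding).mp hH

theorem IsLaman.comap_eq_of_isLaman (hG : IsLaman G) (hH : IsLaman H) (f : H →g G)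
    (hf : Function.Injective f) : G.comap f = H := by
  have := hH.finite
  have hle : H ≤ G.comap f := fun a b hab => f.map_adj hab
  have hinduced := (isLaman_iff_isLamanOn_univ.mp hG).2 (Set.range f) (Set.subset_univ _)
  have hcard : (edgesWithin G (Set.range f)).ncard = (G.comap f).edgeSet.ncard := by
    rw [← Set.image_univ, ← edgesWithin_univ]
    exact ncard_edgesWithin_image (SimpleGraph.Embedding.comap ⟨f, hf⟩ G) _
  rw [hcard, ← Set.image_univ, Set.ncard_image_of_injective _ hf, Set.ncard_univ] at hinduced
  refine SimpleGraph.edgeSet_injective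
    (Set.eq_of_subset_of_ncard_le (SimpleGraph.edgeSet_mono hle) ?_).symm
  have := hH.1
  omega

end Laman

section Glue

variable {W A B : Type*}

/-- The first of the two parts of `W ⊕ (A ⊕ B)`, which meet in `W`. -/
def leftIncl : W ⊕ A ↪ W ⊕ (A ⊕ B) :=
  (Function.Embedding.refl W).sumMap .inl

/-- The second of the two parts of `W ⊕ (A ⊕ B)`, which meet in `W`. -/
def rightIncl : W ⊕ B ↪ W ⊕ (A ⊕ B) :=
  (Function.Embedding.refl W).sumMap .inr

/-- The union of two graphs along the vertex set `W`. -/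
def glue (K₁ : SimpleGraph (W ⊕ A)) (K₂ : SimpleGraph (W ⊕ B)) : SimpleGraph (W ⊕ (A ⊕ B)) :=
  K₁.map leftIncl ⊔ K₂.map rightIncl

theorem leftIncl_eq_rightIncl_iff {x : W ⊕ A} {y : W ⊕ B} :
    leftIncl x = rightIncl y ↔ ∃ w, x = Sum.inl w ∧ y = Sum.inl w := by
  rcases x with x | x <;> rcases y with y | y <;> simp [leftIncl, rightIncl, eq_comm]

theorem range_leftIncl_inter_range_rightIncl :
    Set.range (leftIncl : W ⊕ A → W ⊕ (A ⊕ B)) ∩ Set.range rightIncl = Set.range Sum.inl := by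
  ext x
  constructor
  · rintro ⟨⟨a, rfl⟩, b, hb⟩
    obtain ⟨w, rfl, -⟩ := leftIncl_eq_rightIncl_iff.mp hb.symm
    exact ⟨w, rfl⟩
  · rintro ⟨w, rfl⟩
    exact ⟨⟨Sum.inl w, rfl⟩, Sum.inl w, rfl⟩

theorem range_leftIncl_union_range_rightIncl :
    Set.range (leftIncl : W ⊕ A → W ⊕ (A ⊕ B)) ∪ Set.range rightIncl = Set.univ := by
  refine Set.eq_univ_of_forall ?_
  rintro (w | a | b)
  exacts [.inl ⟨Sum.inl w, rfl⟩, .inl ⟨Sum.inr a, rfl⟩, .inr ⟨Sum.inr b, rfl⟩]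

theorem map_leftIncl_eq_map_rightIncl {d : Sym2 (W ⊕ A)} {e : Sym2 (W ⊕ B)}
    (h : d.map leftIncl = e.map rightIncl) : ∃ c : Sym2 W, d = c.map .inl ∧ e = c.map .inl := by
  induction d with | _ a b =>
  induction e with | _ a' b' =>
  rw [Sym2.map_mk, Sym2.map_mk, Sym2.eq_iff] at h
  simp only [leftIncl_eq_rightIncl_iff] at h
  obtain ⟨⟨v, rfl, rfl⟩, w, rfl, rfl⟩ | ⟨⟨v, rfl, rfl⟩, w, rfl, rfl⟩ := h
  exacts [⟨s(v, w), rfl, rfl⟩, ⟨s(v, w), rfl, Sym2.eq_swap⟩]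

variable {H : SimpleGraph W} {K₁ : SimpleGraph (W ⊕ A)} {K₂ : SimpleGraph (W ⊕ B)}

theorem edgeSet_glue : (glue K₁ K₂).edgeSet =
    Sym2.map leftIncl '' K₁.edgeSet ∪ Sym2.map rightIncl '' K₂.edgeSet := by
  rw [glue, SimpleGraph.edgeSet_sup, SimpleGraph.edgeSet_map, SimpleGraph.edgeSet_map]
  rfl

theorem edgeSet_comap_inl (K : SimpleGraph (W ⊕ A)) :
    (K.comap Sum.inl).edgeSet = Sym2.map Sum.inl ⁻¹' K.edgeSet := by
  ext e
  induction e with | _ a b => rfl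

theorem comap_leftIncl_glue (h₁ : K₁.comap Sum.inl = H) (h₂ : K₂.comap Sum.inl = H) :
    (glue K₁ K₂).comap leftIncl = K₁ := by
  ext a b
  refine ⟨?_, fun hab => .inl ⟨?_, a, b, hab, rfl, rfl⟩⟩
  · rintro (⟨-, c, d, hcd, hc, hd⟩ | ⟨-, c, d, hcd, hc, hd⟩)
    · rwa [← leftIncl.injective hc, ← leftIncl.injective hd]
    · obtain ⟨v, rfl, rfl⟩ := leftIncl_eq_rightIncl_iff.mp hc.symm
      obtain ⟨w, rfl, rfl⟩ := leftIncl_eq_rightIncl_iff.mp hd.symm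
      have hvw : (K₂.comap Sum.inl).Adj v w := hcd
      rwa [h₂, ← h₁] at hvw
  · exact leftIncl.injective.ne hab.ne

theorem comap_rightIncl_glue (h₁ : K₁.comap Sum.inl = H) (h₂ : K₂.comap Sum.inl = H) :
    (glue K₁ K₂).comap rightIncl = K₂ := by
  ext a b
  refine ⟨?_, fun hab => .inr ⟨?_, a, b, hab, rfl, rfl⟩⟩
  · rintro (⟨-, c, d, hcd, hc, hd⟩ | ⟨-, c, d, hcd, hc, hd⟩)
    · obtain ⟨v, rfl, rfl⟩ := leftIncl_eq_rightIncl_iff.mp hc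
      obtain ⟨w, rfl, rfl⟩ := leftIncl_eq_rightIncl_iff.mp hd
      have hvw : (K₁.comap Sum.inl).Adj v w := hcd
      rwa [h₁, ← h₂] at hvw
    · rwa [← rightIncl.injective hc, ← rightIncl.injective hd]
  · exact rightIncl.injective.ne hab.ne

theorem comap_inl_glue (h₁ : K₁.comap Sum.inl = H) (h₂ : K₂.comap Sum.inl = H) :
    (glue K₁ K₂).comap Sum.inl = H :=
  (congrArg (SimpleGraph.comap Sum.inl) (comap_leftIncl_glue h₁ h₂)).trans h₁

theorem isLaman_glue (hH : IsLaman H) (hK₁ : IsLaman K₁) (hK₂ : IsLaman K₂)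
    (h₁ : K₁.comap Sum.inl = H) (h₂ : K₂.comap Sum.inl = H) : IsLaman (glue K₁ K₂) := by
  rw [← comap_inl_glue h₁ h₂] at hH
  rw [← comap_leftIncl_glue h₁ h₂] at hK₁
  rw [← comap_rightIncl_glue h₁ h₂] at hK₂
  rw [isLaman_iff_isLamanOn_univ, ← range_leftIncl_union_range_rightIncl]
  refine IsLamanOn.union ((isLaman_iff_isLamanOn_range (.comap leftIncl _)).mp hK₁)
    ((isLaman_iff_isLamanOn_range (.comap rightIncl _)).mp hK₂) ?_ fun e he => ?_
  · rw [range_leftIncl_inter_range_rightIncl]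
    exact (isLaman_iff_isLamanOn_range (.comap .inl _)).mp hH
  · rw [edgesWithin, edgeSet_glue] at he
    refine he.1.imp ?_ ?_ <;> rintro ⟨⟨a, b⟩, -, rfl⟩
    exacts [⟨⟨a, rfl⟩, b, rfl⟩, ⟨⟨a, rfl⟩, b, rfl⟩]

/-- The edges of `K` with an endpoint outside `W`. -/
def outerEdges (K : SimpleGraph (W ⊕ A)) : Set (Sym2 (W ⊕ A)) :=
  K.edgeSet \ Set.range (Sym2.map Sum.inl)

/-- The edges of a graph on `W ⊕ A` extending `H`, split into those of `H` and the outer ones. -/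
def splitEdge (H : SimpleGraph W) (K : SimpleGraph (W ⊕ A)) :
    H.edgeSet ⊕ outerEdges K → Sym2 (W ⊕ A) :=
  Sum.elim (Sym2.map Sum.inl ∘ Subtype.val) Subtype.val

/-- The edges of a glued graph, split into the common ones and the outer ones of both parts. -/
def gluedEdge (H : SimpleGraph W) (K₁ : SimpleGraph (W ⊕ A)) (K₂ : SimpleGraph (W ⊕ B)) :
    H.edgeSet ⊕ (outerEdges K₁ ⊕ outerEdges K₂) → Sym2 (W ⊕ (A ⊕ B)) :=
  Sum.elim (Sym2.map Sum.inl ∘ Subtype.val)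
    (Sum.elim (Sym2.map leftIncl ∘ Subtype.val) (Sym2.map rightIncl ∘ Subtype.val))

theorem splitEdge_injective : Function.Injective (splitEdge H K₁) := by
  refine ((Sym2.map.injective Sum.inl_injective).comp Subtype.val_injective).sumElim
    Subtype.val_injective ?_
  rintro e ⟨d, -, hd⟩ rfl
  exact hd ⟨e, rfl⟩

theorem range_splitEdge (h : K₁.comap Sum.inl = H) : Set.range (splitEdge H K₁) = K₁.edgeSet := by
  rw [splitEdge, Set.Sum.elim_range, Set.range_comp, Subtype.range_coe, Subtype.range_coe,
    ← h, edgeSet_comap_inl, Set.image_preimage_eq_inter_range, outerEdges, Set.inter_union_sdiff]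

theorem gluedEdge_injective : Function.Injective (gluedEdge H K₁ K₂) := by
  refine ((Sym2.map.injective Sum.inl_injective).comp Subtype.val_injective).sumElim
    (((Sym2.map.injective leftIncl.injective).comp Subtype.val_injective).sumElim
      ((Sym2.map.injective rightIncl.injective).comp Subtype.val_injective) ?_) ?_
  · rintro ⟨d, _, hd⟩ e h
    obtain ⟨c, rfl, -⟩ := map_leftIncl_eq_map_rightIncl h
    exact hd ⟨c, rfl⟩
  · rintro ⟨c, _⟩ (⟨d, _, hd⟩ | ⟨d, _, hd⟩) h
    · have h' : d.map leftIncl = (c.map .inl).map rightIncl :=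
        h.symm.trans (Sym2.map_map (f := Sum.inl) (g := (rightIncl : _ ↪ W ⊕ (A ⊕ B))) c).symm
      obtain ⟨c, rfl, -⟩ := map_leftIncl_eq_map_rightIncl h'
      exact hd ⟨c, rfl⟩
    · have h' : (c.map .inl).map leftIncl = d.map rightIncl :=
        (Sym2.map_map (f := Sum.inl) (g := (leftIncl : _ ↪ W ⊕ (A ⊕ B))) c).trans h
      obtain ⟨c, -, rfl⟩ := map_leftIncl_eq_map_rightIncl h'
      exact hd ⟨c, rfl⟩

theorem range_gluedEdge (h₁ : K₁.comap Sum.inl = H) (h₂ : K₂.comap Sum.inl = H) :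
    Set.range (gluedEdge H K₁ K₂) = (glue K₁ K₂).edgeSet := by
  have hinl : Sym2.map Sum.inl '' H.edgeSet =
      Sym2.map leftIncl '' (Sym2.map (Sum.inl : W → W ⊕ A) '' H.edgeSet) ∪
        Sym2.map rightIncl '' (Sym2.map (Sum.inl : W → W ⊕ B) '' H.edgeSet) := by
    simp only [Set.image_image, Sym2.map_map]
    exact (Set.union_self _).symm
  rw [edgeSet_glue, ← range_splitEdge h₁, ← range_splitEdge h₂]
  simp only [gluedEdge, splitEdge, Set.Sum.elim_range, Set.range_comp, Subtype.range_coe,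
    Set.image_union, hinl]
  exact Set.union_union_union_comm ..

end Glue

section GluedCount

theorem sqLen_mem_polyFun {ι V : Type*} {r : (ι → ℂ) → Realization V}
    (hr : ∀ v i, (fun x => r x v i) ∈ polyFun ℂ ι) (e : Sym2 V) :
    (fun x => sqLen (r x) e) ∈ polyFun ℂ ι := by
  induction e with | _ a b =>
  have h (i) : (fun x => r x a i - r x b i) ∈ polyFun ℂ ι := sub_mem (hr a i) (hr b i)
  simp only [sqLen_mk, dotProduct, Fin.sum_univ_two, Pi.sub_apply]
  exact add_mem (mul_mem (h 0) (h 0)) (mul_mem (h 1) (h 1))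

theorem anchor_mem_polyFun {ι V : Type*} {r : (ι → ℂ) → Realization V}
    (hr : ∀ v i, (fun x => r x v i) ∈ polyFun ℂ ι) (u v : V) (j : Fin 3) :
    (fun x => anchor u v (r x) j) ∈ polyFun ℂ ι := by
  fin_cases j
  · exact hr u 0
  · exact hr u 1
  · exact add_mem (sub_mem (hr v 0) (hr u 0)) (mul_mem
      (Subalgebra.algebraMap_mem _ Complex.I) (sub_mem (hr v 1) (hr u 1)))

variable {W A B : Type*}

/-- The edge lengths and the anchor of a realization, as a polynomial map in its coordinates. -/
noncomputable def baseMap (H : SimpleGraph W) (u v : W) (x : W × Fin 2 → ℂ) :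
    H.edgeSet ⊕ Fin 3 → ℂ :=
  Sum.elim (fun e => sqLen (Function.curry x) e) (anchor u v (Function.curry x))

/-- The lengths of the edges with an endpoint in `A`, as a polynomial map in the coordinates. -/
noncomputable def outerMap (K : SimpleGraph (W ⊕ A)) (x : W × Fin 2 → ℂ) (y : A × Fin 2 → ℂ) :
    outerEdges K → ℂ :=
  fun e => sqLen (Sum.elim (Function.curry x) (Function.curry y)) e

variable {H : SimpleGraph W} {K₁ : SimpleGraph (W ⊕ A)} {K₂ : SimpleGraph (W ⊕ B)} {u v : W}

theorem baseMap_eq_iff {x : W × Fin 2 → ℂ} {t : H.edgeSet ⊕ Fin 3 → ℂ} :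
    baseMap H u v x = t ↔ (∀ e : H.edgeSet, sqLen (Function.curry x) e = t (Sum.inl e)) ∧
      anchor u v (Function.curry x) = t ∘ Sum.inr := by
  simp only [baseMap, funext_iff, Sum.forall, Sum.elim_inl, Sum.elim_inr, Function.comp_apply]

theorem baseMap_mem_polyFun (j : H.edgeSet ⊕ Fin 3) :
    (fun x => baseMap H u v x j) ∈ polyFun ℂ (W × Fin 2) := by
  rcases j with e | i
  · exact sqLen_mem_polyFun (fun w i => coord_mem_polyFun (w, i)) _
  · exact anchor_mem_polyFun (fun w i => coord_mem_polyFun (w, i)) _ _ _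

theorem outerMap_mem_polyFun (e : outerEdges K₁) :
    (fun z : (W × Fin 2) ⊕ (A × Fin 2) → ℂ => outerMap K₁ (z ∘ Sum.inl) (z ∘ Sum.inr) e) ∈
      polyFun ℂ ((W × Fin 2) ⊕ (A × Fin 2)) := by
  refine sqLen_mem_polyFun ?_ _
  rintro (w | a) i
  exacts [coord_mem_polyFun (Sum.inl (w, i)), coord_mem_polyFun (Sum.inr (a, i))]

theorem constructiblePred_outerMap_eq [Finite (outerEdges K₁)] :
    ConstructiblePred fun z : ((W × Fin 2) ⊕ outerEdges K₁) ⊕ (A × Fin 2) → ℂ =>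
      outerMap K₁ (z ∘ Sum.inl ∘ Sum.inl) (z ∘ Sum.inr) = z ∘ Sum.inl ∘ Sum.inr := by
  simp only [funext_iff, Function.comp_apply]
  exact .forall_finite fun e => .eq
    (comp_mem_polyFun (outerMap_mem_polyFun e) (Sum.map Sum.inl id))
    (coord_mem_polyFun (Sum.inl (Sum.inr e)))

/-- Moves the middle summand to the end, with the anchor values behind all edge lengths. -/
def sumRightComm (α β γ : Type*) : (α ⊕ β) ⊕ γ ≃ (α ⊕ γ) ⊕ β :=
  (Equiv.sumAssoc α β γ).trans
    (((Equiv.refl α).sumCongr (Equiv.sumComm β γ)).trans (Equiv.sumAssoc α γ β).symm)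

/-- A realization of `W ⊕ A`, given by its coordinates on `W` and on `A`. -/
def sumRealizationEquiv (W A : Type*) :
    (W × Fin 2 → ℂ) × (A × Fin 2 → ℂ) ≃ Realization (W ⊕ A) :=
  ((Equiv.curry _ _ _).prodCongr (Equiv.curry _ _ _)).trans
    (Equiv.sumArrowEquivProdArrow W A (Fin 2 → ℂ)).symm

theorem sumRealizationEquiv_apply (z : (W × Fin 2 → ℂ) × (A × Fin 2 → ℂ)) :
    sumRealizationEquiv W A z = Sum.elim (Function.curry z.1) (Function.curry z.2) := rfl

theorem generic_enatCard_baseMap_eq (huv : H.Adj u v) {h : ℕ} (hH : IsGenericCount H h) :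
    Generic fun t => ENat.card {x // baseMap H u v x = t} = h := by
  rw [isGenericCount_iff_anchored huv Subtype.val_injective Subtype.range_val] at hH
  refine hH.mono fun t ht => ?_
  rw [← ht]
  exact ENat.card_congr (Equiv.subtypeEquiv (Equiv.curry _ _ _) fun x => baseMap_eq_iff)

theorem generic_enatCard_outerMap_eq (huv : H.Adj u v) (h₁ : K₁.comap Sum.inl = H) {g : ℕ}
    (hK : IsGenericCount K₁ g) : Generic fun t : (H.edgeSet ⊕ Fin 3) ⊕ outerEdges K₁ → ℂ =>
      ENat.card {z : (W × Fin 2 → ℂ) × (A × Fin 2 → ℂ) //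
        baseMap H u v z.1 = t ∘ Sum.inl ∧ outerMap K₁ z.1 z.2 = t ∘ Sum.inr} = g := by
  have huv' : K₁.Adj (Sum.inl u) (Sum.inl v) := by rwa [← h₁] at huv
  rw [isGenericCount_iff_anchored huv' splitEdge_injective (range_splitEdge h₁)] at hK
  refine (hK.comp_injective (sumRightComm _ _ _).injective).mono fun t ht => ?_
  rw [← ht]
  refine ENat.card_congr (Equiv.subtypeEquiv (sumRealizationEquiv W A) fun z => ?_)
  rw [sumRealizationEquiv_apply, baseMap_eq_iff, Sum.forall]
  simp only [splitEdge, Sum.elim_inl, Sum.elim_inr, Function.comp_apply, ← sqLen_comp,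
    Sum.elim_comp_inl, funext_iff (f := outerMap _ _ _)]
  exact and_right_comm

/-- A realization of `W ⊕ (A ⊕ B)`, given by its coordinates on `W`, `A` and `B`. -/
def gluedRealizationEquiv (W A B : Type*) :
    (W × Fin 2 → ℂ) × ((A × Fin 2 → ℂ) × (B × Fin 2 → ℂ)) ≃ Realization (W ⊕ (A ⊕ B)) :=
  ((Equiv.curry _ _ _).prodCongr (sumRealizationEquiv A B)).trans
    (Equiv.sumArrowEquivProdArrow W (A ⊕ B) (Fin 2 → ℂ)).symm

theorem gluedRealizationEquiv_comp_inl
    (z : (W × Fin 2 → ℂ) × ((A × Fin 2 → ℂ) × (B × Fin 2 → ℂ))) :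
    gluedRealizationEquiv W A B z ∘ Sum.inl = Function.curry z.1 := rfl

theorem gluedRealizationEquiv_comp_leftIncl
    (z : (W × Fin 2 → ℂ) × ((A × Fin 2 → ℂ) × (B × Fin 2 → ℂ))) :
    gluedRealizationEquiv W A B z ∘ leftIncl =
      Sum.elim (Function.curry z.1) (Function.curry z.2.1) := by
  funext x
  rcases x with x | x <;> rfl

theorem gluedRealizationEquiv_comp_rightIncl
    (z : (W × Fin 2 → ℂ) × ((A × Fin 2 → ℂ) × (B × Fin 2 → ℂ))) :
    gluedRealizationEquiv W A B z ∘ rightIncl =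
      Sum.elim (Function.curry z.1) (Function.curry z.2.2) := by
  funext x
  rcases x with x | x <;> rfl

theorem exists_isGenericCount_glue [Finite A] [Finite B] (hH : IsLaman H)
    (h₁ : K₁.comap Sum.inl = H) (h₂ : K₂.comap Sum.inl = H) {h g₁ g₂ : ℕ} (h0 : h ≠ 0)
    (hh : IsGenericCount H h) (hg₁ : IsGenericCount K₁ g₁) (hg₂ : IsGenericCount K₂ g₂) :
    ∃ N, h * N = g₁ * g₂ ∧ IsGenericCount (glue K₁ K₂) N := by
  obtain ⟨u, v, huv⟩ := hH.exists_adj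
  have := hH.finite
  have hcard : Nat.card (H.edgeSet ⊕ Fin 3) = Nat.card (W × Fin 2) := by
    rw [Nat.card_sum, Nat.card_prod, Nat.card_coe_set_eq, Nat.card_fin, Nat.card_fin, hH.1,
      mul_comm]
  obtain ⟨N, hN, hgen⟩ := exists_generic_glued_count hcard baseMap_mem_polyFun
    (q := fun x s y => outerMap K₁ x y = s) (q' := fun x s y => outerMap K₂ x y = s)
    constructiblePred_outerMap_eq constructiblePred_outerMap_eq h0
    (generic_enatCard_baseMap_eq huv hh) (generic_enatCard_outerMap_eq huv h₁ hg₁)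
    (generic_enatCard_outerMap_eq huv h₂ hg₂)
  refine ⟨N, hN, ?_⟩
  have huv' : (glue K₁ K₂).Adj (Sum.inl u) (Sum.inl v) := by
    rwa [← comap_inl_glue h₁ h₂] at huv
  rw [isGenericCount_iff_anchored huv' gluedEdge_injective (range_gluedEdge h₁ h₂)]
  refine (hgen.comp_injective (sumRightComm _ _ _).injective).mono fun t ht => ?_
  rw [← ht]
  refine (ENat.card_congr (Equiv.subtypeEquiv (gluedRealizationEquiv W A B) fun z => ?_)).symm
  rw [baseMap_eq_iff, Sum.forall, Sum.forall]
  simp only [gluedEdge, Sum.elim_inl, Sum.elim_inr, Function.comp_apply, ← sqLen_comp,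
    gluedRealizationEquiv_comp_inl, gluedRealizationEquiv_comp_leftIncl,
    gluedRealizationEquiv_comp_rightIncl, funext_iff (f := outerMap _ _ _)]
  exact and_right_comm

end GluedCount

section GluedGraph

/-- A type, split along the image of an injective map. -/
noncomputable def sumComplEquiv {W V : Type*} (f : W → V) (hf : Function.Injective f) :
    W ⊕ ((Set.range f)ᶜ : Set V) ≃ V := by
  classical
  exact ((Equiv.ofInjective f hf).sumCongr (Equiv.refl _)).trans (Equiv.Set.sumCompl _)

theorem sumComplEquiv_inl {W V : Type*} (f : W → V) (hf : Function.Injective f) (w : W) :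
    sumComplEquiv f hf (Sum.inl w) = f w := by
  simp [sumComplEquiv]

theorem IsLaman.exists_iso_comap_inl_eq {W V : Type*} {H : SimpleGraph W} {G : SimpleGraph V}
    (hG : IsLaman G) (hH : IsLaman H) (f : H →g G) (hf : Function.Injective f) :
    ∃ K : SimpleGraph (W ⊕ ((Set.range f)ᶜ : Set V)), Nonempty (G ≃g K) ∧
      K.comap Sum.inl = H := by
  let e := sumComplEquiv f hf
  refine ⟨G.comap e, ⟨(SimpleGraph.Iso.comap e G).symm⟩, ?_⟩
  refine .trans ?_ (hG.comap_eq_of_isLaman hH f hf)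
  exact congrArg G.comap (funext (sumComplEquiv_inl f hf))

theorem exists_glued_graph {W V₁ V₂ : Type*} {H : SimpleGraph W} {G₁ : SimpleGraph V₁}
    {G₂ : SimpleGraph V₂} (hH : IsLaman H) (hG₁ : IsLaman G₁) (hG₂ : IsLaman G₂) (f₁ : H →g G₁)
    (hf₁ : Function.Injective f₁) (f₂ : H →g G₂) (hf₂ : Function.Injective f₂) {h g₁ g₂ : ℕ}
    (h0 : h ≠ 0) (ch : IsGenericCount H h) (c₁ : IsGenericCount G₁ g₁) (c₂ : IsGenericCount G₂ g₂)
    {n : ℕ} (hn : n + Nat.card W = Nat.card V₁ + Nat.card V₂) :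
    ∃ (K : SimpleGraph (Fin n)) (N : ℕ), IsLaman K ∧ (∃ f : H →g K, Function.Injective f) ∧
      h * N = g₁ * g₂ ∧ IsGenericCount K N := by
  have := hG₁.finite
  have := hG₂.finite
  have := hH.finite
  obtain ⟨K₁, ⟨i₁⟩, r₁⟩ := hG₁.exists_iso_comap_inl_eq hH f₁ hf₁
  obtain ⟨K₂, ⟨i₂⟩, r₂⟩ := hG₂.exists_iso_comap_inl_eq hH f₂ hf₂
  obtain ⟨_, _, a₁⟩ := hG₁.exists_adj
  obtain ⟨_, _, a₂⟩ := hG₂.exists_adj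
  obtain ⟨N, hN, cN⟩ := exists_isGenericCount_glue hH r₁ r₂ h0 ch (c₁.of_iso i₁ a₁)
    (c₂.of_iso i₂ a₂)
  have hL := isLaman_glue hH (hG₁.of_iso i₁) (hG₂.of_iso i₂) r₁ r₂
  have hcard : Nat.card (W ⊕ (((Set.range f₁)ᶜ : Set V₁) ⊕ ((Set.range f₂)ᶜ : Set V₂))) = n := by
    have k₁ := Nat.card_congr (sumComplEquiv f₁ hf₁)
    have k₂ := Nat.card_congr (sumComplEquiv f₂ hf₂)
    rw [Nat.card_sum] at k₁ k₂ ⊢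
    rw [Nat.card_sum]
    omega
  let i := SimpleGraph.Iso.map (Finite.equivFinOfCardEq hcard) (glue K₁ K₂)
  let f : H →g glue K₁ K₂ := ⟨Sum.inl, fun hab => by rwa [← comap_inl_glue r₁ r₂] at hab⟩
  obtain ⟨_, _, a⟩ := hL.exists_adj
  exact ⟨_, N, hL.of_iso i, ⟨i.toHom.comp f, i.injective.comp Sum.inl_injective⟩, hN,
    cN.of_iso i a⟩

end GluedGraph

section SmallGraphs

theorem ncard_edgesWithin_top {V : Type*} {S : Set V} (hS : S.Finite) :
    (edgesWithin (⊤ : SimpleGraph V) S).ncard = S.ncard.choose 2 := by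
  classical
  have := hS.fintype
  have himage := ncard_edgesWithin_image
    (SimpleGraph.Embedding.completeGraph (Function.Embedding.subtype (· ∈ S))) Set.univ
  rw [edgesWithin_univ, Set.image_univ] at himage
  rw [← Nat.card_coe_set_eq S, Nat.card_eq_fintype_card,
    ← SimpleGraph.card_edgeFinset_top_eq_card_choose_two, ← Set.ncard_coe_finset,
    SimpleGraph.coe_edgeFinset, ← himage]
  congr 2
  exact Subtype.range_coe.symm

theorem isLaman_top {V : Type*} (hV : Nat.card V = 2 ∨ Nat.card V = 3) :
    IsLaman (⊤ : SimpleGraph V) := by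
  have : Finite V := Nat.finite_of_card_ne_zero (by omega)
  rw [isLaman_iff_isLamanOn_univ]
  refine ⟨?_, fun X _ hX => ?_⟩
  · rw [ncard_edgesWithin_top Set.finite_univ, Set.ncard_univ]
    rcases hV with h | h <;> rw [h] <;> rfl
  · have hle : X.ncard ≤ 3 := (Set.ncard_le_card X).trans (by omega)
    rw [ncard_edgesWithin_top X.toFinite]
    interval_cases X.ncard <;> decide

/-- A realization, given by the position of the vertex `0` and the isotropic coordinates of the
vectors from there to the other vertices. -/
noncomputable def isotropicEquiv (n : ℕ) :
    Realization (Fin (n + 1)) ≃ (Fin 2 → ℂ) × (Fin n → ℂ × ℂ) where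
  toFun ρ := (ρ 0, fun i => isotropic (ρ i.succ - ρ 0))
  invFun z := Fin.cons z.1 fun i => z.1 + isotropic.symm (z.2 i)
  left_inv ρ := by
    funext i
    cases i using Fin.cases <;> simp
  right_inv z := by simp

theorem enatCard_anchored_edge {s : Fin 3 → ℂ} (hs : s 2 ≠ 0) (a : ℂ) :
    ENat.card {ρ : Realization (Fin 2) // sqLen ρ s(0, 1) = a ∧ anchor 0 1 ρ = s} = 1 := by
  have solution_iff (ρ : Realization (Fin 2)) : (sqLen ρ s(0, 1) = a ∧ anchor 0 1 ρ = s) ↔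
      isotropicEquiv 1 ρ = (![s 0, s 1], fun _ => (s 2, a / s 2)) := by
    have isotropicEquiv_eq_iff : isotropicEquiv 1 ρ = (![s 0, s 1], fun _ => (s 2, a / s 2)) ↔
        ρ 0 = ![s 0, s 1] ∧ isotropic (ρ 1 - ρ 0) = (s 2, a / s 2) := by
      rw [Prod.ext_iff, funext_iff (f := (isotropicEquiv 1 ρ).2), Fin.forall_fin_one]
      rfl
    rw [isotropicEquiv_eq_iff, anchor_eq_iff, sqLen_eq_isotropic, and_left_comm, Prod.ext_iff,
      and_comm (a := _ = a)]
    refine and_congr_right fun _ => and_congr_right fun h => ?_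
    rw [h, eq_div_iff hs, mul_comm]
  rw [ENat.card_congr (Equiv.subtypeEquiv (q := (· = (_, _))) (isotropicEquiv 1) solution_iff)]
  simp

theorem isGenericCount_edge : IsGenericCount (⊤ : SimpleGraph (Fin 2)) 1 := by
  have hrange : Set.range (fun _ : Unit => s((0 : Fin 2), 1)) =
      (⊤ : SimpleGraph (Fin 2)).edgeSet := by
    ext e
    induction e with | _ a b =>
    fin_cases a <;> fin_cases b <;> simp
  rw [isGenericCount_iff_anchored (show (⊤ : SimpleGraph (Fin 2)).Adj 0 1 by simp)
    (Function.injective_of_subsingleton _) hrange]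
  refine (Generic.apply_ne_zero (Sum.inr 2)).mono fun t ht => ?_
  simp only [Unique.forall_iff]
  exact enatCard_anchored_edge (s := t ∘ Sum.inr) ht _

theorem encard_setOf_add_eq_and_mul_eq {K : Type*} [Field K] [IsAlgClosed K] {d e : K}
    (h : d ^ 2 ≠ 4 * e) : {p : K × K | p.1 + p.2 = d ∧ p.1 * p.2 = e}.encard = 2 := by
  obtain ⟨r, hr⟩ := IsAlgClosed.exists_root
    (Polynomial.C 1 * Polynomial.X ^ 2 + Polynomial.C (-d) * Polynomial.X + Polynomial.C e)
    (by rw [Polynomial.degree_quadratic one_ne_zero]; decide)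
  have hroot : r * (d - r) = e := by
    simp only [Polynomial.IsRoot, Polynomial.eval_add, Polynomial.eval_mul, Polynomial.eval_pow,
      Polynomial.eval_C, Polynomial.eval_X] at hr
    linear_combination -hr
  have hne : r ≠ d - r := fun heq => h (by linear_combination (2 * r - d) * heq + 4 * hroot)
  have hset : {p : K × K | p.1 + p.2 = d ∧ p.1 * p.2 = e} = {(r, d - r), (d - r, r)} := by
    ext ⟨x, y⟩
    simp only [Set.mem_ofPred_eq, Set.mem_insert_iff, Set.mem_singleton_iff, Prod.mk.injEq]
    constructor
    · rintro ⟨hadd, hmul⟩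
      have hfactor : (x - r) * (x - (d - r)) = 0 := by
        linear_combination x * hadd - hmul + hroot
      refine (mul_eq_zero.mp hfactor).imp ?_ ?_ <;> intro hx <;>
        exact ⟨by linear_combination hx, by linear_combination hadd - hx⟩
    · rintro (⟨rfl, rfl⟩ | ⟨rfl, rfl⟩)
      · exact ⟨add_sub_cancel _ _, hroot⟩
      · exact ⟨sub_add_cancel _ _, by rw [mul_comm, hroot]⟩
  rw [hset, Set.encard_pair (fun heq => hne (congrArg Prod.fst heq))]

/-- In isotropic coordinates, these are the points common to two circles. -/
theorem encard_setOf_mul_eq_and_sub_mul_sub_eq {K : Type*} [Field K] [IsAlgClosed K]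
    {b c s m : K} (hs : s ≠ 0) (hm : m ≠ 0) (h : (s * m + b - c) ^ 2 ≠ 4 * (s * m * b)) :
    {p : K × K | p.1 * p.2 = b ∧ (p.1 - s) * (p.2 - m) = c}.encard = 2 := by
  let scale : K × K ≃ K × K := (Equiv.mulLeft₀ m hm).prodCongr (Equiv.mulLeft₀ s hs)
  rw [← encard_setOf_add_eq_and_mul_eq h, ← Set.encard_preimage_of_bijective scale.bijective
    {p : K × K | p.1 + p.2 = _ ∧ p.1 * p.2 = _}]
  congr 1
  ext ⟨x, y⟩
  have hmul : m * x * (s * y) = s * m * b ↔ x * y = b := by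
    rw [mul_mul_mul_comm, mul_comm m s, mul_right_inj' (mul_ne_zero hs hm)]
  change x * y = b ∧ (x - s) * (y - m) = c ↔
    m * x + s * y = s * m + b - c ∧ m * x * (s * y) = s * m * b
  rw [hmul, and_comm]
  refine and_congr_left fun hxy => ⟨fun hc => ?_, fun hc => ?_⟩
  · linear_combination hxy - hc
  · linear_combination hxy - hc

theorem enatCard_anchored_triangle {a b c : ℂ} {s : Fin 3 → ℂ} (hs : s 2 ≠ 0) (ha : a ≠ 0)
    (h : (a + b - c) ^ 2 ≠ 4 * (a * b)) :
    ENat.card {ρ : Realization (Fin 3) //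
      (sqLen ρ s(0, 1) = a ∧ sqLen ρ s(0, 2) = b ∧ sqLen ρ s(1, 2) = c) ∧
        anchor 0 1 ρ = s} = 2 := by
  let thirdVertex : Set (ℂ × ℂ) := {p | p.1 * p.2 = b ∧ (p.1 - s 2) * (p.2 - a / s 2) = c}
  let place (p : ℂ × ℂ) : (Fin 2 → ℂ) × (Fin 2 → ℂ × ℂ) := (![s 0, s 1], ![(s 2, a / s 2), p])
  have place_injective : Function.Injective place := fun p q hpq =>
    congrFun (congrArg Prod.snd hpq) 1
  have solution_iff (ρ : Realization (Fin 3)) :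
      ((sqLen ρ s(0, 1) = a ∧ sqLen ρ s(0, 2) = b ∧ sqLen ρ s(1, 2) = c) ∧ anchor 0 1 ρ = s) ↔
        isotropicEquiv 2 ρ ∈ place '' thirdVertex := by
    have hdiff : isotropic (ρ 2 - ρ 1) = isotropic (ρ 2 - ρ 0) - isotropic (ρ 1 - ρ 0) := by
      rw [← map_sub, sub_sub_sub_cancel_right]
    have place_eq_iff (p : ℂ × ℂ) : place p = isotropicEquiv 2 ρ ↔ ![s 0, s 1] = ρ 0 ∧
        (s 2, a / s 2) = isotropic (ρ 1 - ρ 0) ∧ p = isotropic (ρ 2 - ρ 0) := by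
      rw [Prod.ext_iff, funext_iff (f := (place p).2), Fin.forall_fin_two]
      rfl
    simp only [Set.mem_image, place_eq_iff, anchor_eq_iff, sqLen_eq_isotropic, hdiff, thirdVertex]
    constructor
    · rintro ⟨⟨rfl, hb, hc⟩, h0, h1⟩
      rw [← h1, mul_div_cancel_left₀ _ (h1 ▸ hs)]
      exact ⟨_, ⟨hb, hc⟩, h0.symm, rfl, rfl⟩
    · rintro ⟨_, ⟨hb, hc⟩, h0, h1, rfl⟩
      rw [← h1]
      exact ⟨⟨mul_div_cancel₀ _ hs, hb, hc⟩, h0.symm, rfl⟩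
  rw [ENat.card_congr (Equiv.subtypeEquiv (isotropicEquiv 2) solution_iff),
    ENat.card_coe_set_eq, place_injective.encard_image]
  refine encard_setOf_mul_eq_and_sub_mul_sub_eq hs (div_ne_zero ha hs) ?_
  rwa [mul_div_cancel₀ _ hs]

theorem isGenericCount_triangle : IsGenericCount (⊤ : SimpleGraph (Fin 3)) 2 := by
  let ε : Fin 3 → Sym2 (Fin 3) := ![s(0, 1), s(0, 2), s(1, 2)]
  have hε : Function.Injective ε := by decide
  have hrange : Set.range ε = (⊤ : SimpleGraph (Fin 3)).edgeSet := by
    have mem_range_iff : ∀ e : Sym2 (Fin 3), (∃ i, ε i = e) ↔ ¬ e.IsDiag := by decide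
    rw [SimpleGraph.edgeSet_top]
    exact Set.ext mem_range_iff
  rw [isGenericCount_iff_anchored (show (⊤ : SimpleGraph (Fin 3)).Adj 0 1 by simp) hε hrange]
  have hdiscr : Generic fun t : Fin 3 ⊕ Fin 3 → ℂ =>
      (t (Sum.inl 0) + t (Sum.inl 1) - t (Sum.inl 2)) ^ 2 ≠
        4 * (t (Sum.inl 0) * t (Sum.inl 1)) := by
    let D : MvPolynomial (Fin 3 ⊕ Fin 3) ℂ :=
      (MvPolynomial.X (Sum.inl 0) + MvPolynomial.X (Sum.inl 1) - MvPolynomial.X (Sum.inl 2)) ^ 2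
        - 4 * (MvPolynomial.X (Sum.inl 0) * MvPolynomial.X (Sum.inl 1))
    have hD : D ≠ 0 := fun h => by
      simpa [D] using congrArg (MvPolynomial.eval (Sum.elim ![0, 0, 1] 0)) h
    exact (Generic.of_eval_ne_zero hD).mono fun t ht => by simpa [D, sub_ne_zero] using ht
  refine (hdiscr.and ((Generic.apply_ne_zero (Sum.inl 0)).and
    (Generic.apply_ne_zero (Sum.inr 2)))).mono ?_
  rintro t ⟨hd, ha, hs⟩
  simp only [Fin.forall_fin_succ, IsEmpty.forall_iff, and_true]
  exact enatCard_anchored_triangle (s := t ∘ Sum.inr) hs ha hd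

end SmallGraphs

section LowerBounds

variable {W V : Type*} {H : SimpleGraph W} {G : SimpleGraph V}

theorem lam_eq_of_isGenericCount {N : ℕ} (h : IsGenericCount G N) : lam G = N :=
  IsGenericCount.unique (Nat.sInf_mem (s := {N | IsGenericCount G N}) ⟨N, h⟩) h

theorem isGenericCount_lam (h : lam G ≠ 0) : IsGenericCount G (lam G) :=
  Nat.sInf_mem (Nat.nonempty_of_pos_sInf (Nat.pos_of_ne_zero h))

theorem le_maxLam {n N : ℕ} {K : SimpleGraph (Fin n)} (hK : IsLaman K) (h : IsGenericCount K N) :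
    N ≤ maxLam n :=
  le_csSup (finite_lamanNumbers n).bddAbove ⟨K, hK, lam_eq_of_isGenericCount h⟩

/-- An edge of a graph, as a homomorphism from the complete graph on two vertices. -/
def edgeHom {u v : V} (huv : G.Adj u v) : (⊤ : SimpleGraph (Fin 2)) →g G where
  toFun := ![u, v]
  map_rel' {i j} hij := by
    fin_cases i <;> fin_cases j
    · exact absurd rfl hij
    · exact huv
    · exact huv.symm
    · exact absurd rfl hij

/-- A triangle of a graph, as a homomorphism from the complete graph on three vertices. -/
def triangleHom {a b c : V} (hab : G.Adj a b) (hbc : G.Adj b c) (hac : G.Adj a c) :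
    (⊤ : SimpleGraph (Fin 3)) →g G where
  toFun := ![a, b, c]
  map_rel' {i j} hij := by
    fin_cases i <;> fin_cases j
    · exact absurd rfl hij
    · exact hab
    · exact hac
    · exact hab.symm
    · exact absurd rfl hij
    · exact hbc
    · exact hac.symm
    · exact hbc.symm
    · exact absurd rfl hij

theorem exists_isGenericCount_two_pow_mul {m N : ℕ} {K : SimpleGraph (Fin m)} (hK : IsLaman K)
    (hN : IsGenericCount K N) (r : ℕ) :
    ∃ K' : SimpleGraph (Fin (m + r)), IsLaman K' ∧ IsGenericCount K' (2 ^ r * N) := by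
  induction r with
  | zero => exact ⟨K, hK, by simpa using hN⟩
  | succ r ih =>
    obtain ⟨K', hK', hN'⟩ := ih
    obtain ⟨u, v, huv⟩ := hK'.exists_adj
    let f₁ := edgeHom huv
    -- Gluing a triangle along an edge adds a vertex of degree two.
    let f₂ : (⊤ : SimpleGraph (Fin 2)) →g (⊤ : SimpleGraph (Fin 3)) :=
      ⟨Fin.castSucc, fun hab => (Fin.castSucc_injective 2).ne hab⟩
    obtain ⟨L, M, hL, -, hM, cM⟩ := exists_glued_graph (n := m + (r + 1))
      (isLaman_top (Or.inl (by simp))) hK' (isLaman_top (Or.inr (by simp)))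
      f₁ (SimpleGraph.Hom.injective_of_top_hom f₁) f₂ (SimpleGraph.Hom.injective_of_top_hom f₂)
      one_ne_zero isGenericCount_edge hN' isGenericCount_triangle (by simp; ring)
    refine ⟨L, hL, ?_⟩
    rwa [show 2 ^ (r + 1) * N = M by rw [← one_mul M, hM]; ring]

theorem exists_isGenericCount_glued_copies (hH : IsLaman H) (hG : IsLaman G) (f : H →g G)
    (hf : Function.Injective f) {h g : ℕ} (h0 : h ≠ 0) (ch : IsGenericCount H h) (q : ℕ)
    (cg : q ≠ 0 → IsGenericCount G g) :
    ∃ (K : SimpleGraph (Fin (Nat.card W + q * (Nat.card V - Nat.card W)))) (N : ℕ),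
      IsLaman K ∧ (∃ f : H →g K, Function.Injective f) ∧ N * h ^ q = h * g ^ q ∧
        IsGenericCount K N := by
  have := hH.finite
  have := hG.finite
  induction q with
  | zero =>
    rw [zero_mul, add_zero]
    let i := SimpleGraph.Iso.map (Finite.equivFin W) H
    obtain ⟨_, _, a⟩ := hH.exists_adj
    exact ⟨_, h, hH.of_iso i, ⟨i.toHom, i.injective⟩, by simp, ch.of_iso i a⟩
  | succ q ih =>
    have cg := cg (Nat.succ_ne_zero q)
    obtain ⟨K, N, hK, ⟨f', hf'⟩, hN, cN⟩ := ih fun _ => cg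
    have hcard : Nat.card W ≤ Nat.card V := Nat.card_le_card_of_injective f hf
    have card_glued : Nat.card W + (q + 1) * (Nat.card V - Nat.card W) + Nat.card W =
        Nat.card (Fin (Nat.card W + q * (Nat.card V - Nat.card W))) + Nat.card V := by
      obtain ⟨d, hd⟩ := Nat.exists_eq_add_of_le hcard
      rw [hd, Nat.add_sub_cancel_left, Nat.card_fin]
      ring
    obtain ⟨K', N', hK', hf'', hN', cN'⟩ :=
      exists_glued_graph hH hK hG f' hf' f hf h0 ch cN cg card_glued
    refine ⟨K', N', hK', hf'', ?_, cN'⟩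
    calc N' * h ^ (q + 1) = h * N' * h ^ q := by ring
      _ = (N * h ^ q) * g := by rw [hN']; ring
      _ = h * g ^ (q + 1) := by rw [hN]; ring

theorem le_maxLam_of_injective_hom (hH : IsLaman H) (hG : IsLaman G) (f : H →g G)
    (hf : Function.Injective f) {n : ℕ} (hn : Nat.card W ≤ n) :
    (2 : ℝ) ^ ((n - Nat.card W) % (Nat.card V - Nat.card W)) * (lam H : ℝ) *
        ((lam G : ℝ) / (lam H : ℝ)) ^ ((n - Nat.card W) / (Nat.card V - Nat.card W)) ≤
      (maxLam n : ℝ) := by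
  have hn' : Nat.card W + (n - Nat.card W) / (Nat.card V - Nat.card W) *
      (Nat.card V - Nat.card W) + (n - Nat.card W) % (Nat.card V - Nat.card W) = n := by
    have := Nat.div_add_mod' (n - Nat.card W) (Nat.card V - Nat.card W)
    omega
  generalize (n - Nat.card W) / (Nat.card V - Nat.card W) = q at hn' ⊢
  generalize (n - Nat.card W) % (Nat.card V - Nat.card W) = r at hn' ⊢
  -- `lam` is zero for a graph without a generic count; the bound is then trivial.
  by_cases h0 : lam H = 0
  · simp [h0]
  by_cases hq : q ≠ 0 ∧ lam G = 0
  · simp [hq.1, hq.2]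
  obtain ⟨K, N, hK, -, hN, cN⟩ := exists_isGenericCount_glued_copies hH hG f hf h0
    (isGenericCount_lam h0) q fun hq0 => isGenericCount_lam fun hg => hq ⟨hq0, hg⟩
  obtain ⟨K', hK', cN'⟩ := exists_isGenericCount_two_pow_mul hK cN r
  have hmax := le_maxLam hK' cN'
  rw [hn'] at hmax
  have hh : (lam H : ℝ) ≠ 0 := by exact_mod_cast h0
  have hN' : (N : ℝ) * (lam H : ℝ) ^ q = lam H * (lam G : ℝ) ^ q := by exact_mod_cast hN
  have heq : (lam H : ℝ) * ((lam G : ℝ) / lam H) ^ q = N := by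
    rw [div_pow, ← mul_div_assoc, div_eq_iff (pow_ne_zero q hh), hN']
  rw [mul_assoc, heq]
  exact_mod_cast hmax

end LowerBounds

end LamanCount

theorem mainTheorem3 {V : Type*} [Fintype V] (G : SimpleGraph V) (hG : LamanCount.IsLaman G) :
    (2 < Fintype.card V → ∀ n : ℕ, 2 ≤ n →
      2 ^ ((n - 2) % (Fintype.card V - 2)) *
          LamanCount.lam G ^ ((n - 2) / (Fintype.card V - 2))
        ≤ LamanCount.maxLam n) ∧
    ((∃ a b c : V, G.Adj a b ∧ G.Adj b c ∧ G.Adj a c) → 3 < Fintype.card V → ∀ n : ℕ, 3 ≤ n →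
      (2 : ℝ) ^ ((n - 3) % (Fintype.card V - 3)) * 2 *
          ((LamanCount.lam G : ℝ) / 2) ^ ((n - 3) / (Fintype.card V - 3))
        ≤ (LamanCount.maxLam n : ℝ)) ∧
    (∀ H : G.Subgraph, LamanCount.IsLaman H.coe → H.verts.ncard < Fintype.card V →
      ∀ n : ℕ, H.verts.ncard ≤ n →
      (2 : ℝ) ^ ((n - H.verts.ncard) % (Fintype.card V - H.verts.ncard)) *
          (LamanCount.lam H.coe : ℝ) *
          ((LamanCount.lam G : ℝ) / (LamanCount.lam H.coe : ℝ)) ^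
            ((n - H.verts.ncard) / (Fintype.card V - H.verts.ncard))
        ≤ (LamanCount.maxLam n : ℝ)) := by
  rw [← Nat.card_eq_fintype_card]
  refine ⟨fun _ n hn => ?_, ?_, fun H hH _ n hn => ?_⟩
  · obtain ⟨u, v, huv⟩ := hG.exists_adj
    let f := LamanCount.edgeHom huv
    have h := LamanCount.le_maxLam_of_injective_hom
      (LamanCount.isLaman_top (Or.inl (Nat.card_fin 2))) hG f
      (SimpleGraph.Hom.injective_of_top_hom f) (n := n) (by rwa [Nat.card_fin])
    rw [LamanCount.lam_eq_of_isGenericCount LamanCount.isGenericCount_edge, Nat.card_fin,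
      Nat.cast_one, mul_one, div_one] at h
    exact_mod_cast h
  · rintro ⟨a, b, c, hab, hbc, hac⟩ _ n hn
    let f := LamanCount.triangleHom hab hbc hac
    have h := LamanCount.le_maxLam_of_injective_hom
      (LamanCount.isLaman_top (Or.inr (Nat.card_fin 3))) hG f
      (SimpleGraph.Hom.injective_of_top_hom f) (n := n) (by rwa [Nat.card_fin])
    rwa [LamanCount.lam_eq_of_isGenericCount LamanCount.isGenericCount_triangle,
      Nat.card_fin, Nat.cast_ofNat] at h
  · exact LamanCount.le_maxLam_of_injective_hom hH hG H.hom H.hom_injective hn
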